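/- Maximum Minimal Hitting Set (MMHS) is the problem where, given a finite hypergraph $\mathcal H$ and a positive integer $\beta$, one has to decide whether $\mathrm{mmhs}(\mathcal H)\ge\beta$, where $\mathrm{mmhs}(\mathcal H)$ is the size of a largest inclusion-wise minimal hitting set of $\mathcal H$ (and $0$ if $\mathcal H$ has no hitting set, that is, if $\emptyset$ is a hyperedge). For an instance $I=(\mathcal H,\beta)$ let $|I|$ be its size and let $\alpha=\alpha(\mathcal H)$ be the maximum size of a hyperedge of $\mathcal H$ ($0$ if there is no hyperedge). Running times are measured on multi-tape (multi-stack) Turing machines. The following hold. 1. MMHS parameterized by $\beta$ is in $\mathsf{XP}$: there are computable functions $f,g:\mathbb N\to\mathbb N$ such that MMHS can be decided in time $f(\beta)\cdot|I|^{g(\beta)}$. 2. MMHS parameterized by $\alpha+\beta$ is $\mathsf{FPT}$: there are a computable function $f:\mathbb N\to\mathbb N$ and a constant $d$ such that MMHS can be decided in time $f(\alpha+\beta)\cdot|I|^{d}$. 3. More precisely, for every real constant $c>0$ (in particular, for every constant $c$ for which $s_2(\alpha,\beta)=(c\beta\log(\alpha\beta))^{\alpha}$ is an upper bound in the sunflower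 lemma for $\beta$ petals and sets of size at most $\alpha$), there are an algorithm that decides MMHS and a polynomial $p$ such that the running time on every instance $I=(\mathcal H,\beta)$ is at most $$p(|I|)\cdot\alpha^{\beta}\,\bigl(c\,\beta\log(\alpha\beta)\bigr)^{\alpha\beta}\ \text{ if } \alpha\beta\ge 2,\qquad\text{and at most } p(|I|)\ \text{ if } \alpha\beta\le 1,$$ where $\log$ is the natural logarithm. -/

import Mathlib

open scoped Hypergraph

/-! ### Decision problems, running times, `FPT`, `XP` and `O*` -/

/-- A (classical) decision problem over a fixed finite alphabet: its instances, their encodings as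
words, and the set of yes-instances. -/
structure DecisionProblem where
  /-- the instances -/
  Instance : Type
  /-- the word over the alphabet `{0, 1, #}` that encodes an instance (`none` is `#`) -/
  encode : Instance → List (Option Bool)
  /-- different instances have different encodings -/
  encode_injective : Function.Injective encode
  /-- the yes-instances -/
  Yes : Instance → Prop

namespace DecisionProblem

variable (P : DecisionProblem)

/-- The size `|I|` of an instance: the length of its encoding. -/
def size (x : P.Instance) : ℕ := (P.encode x).length

open Classical in
/-- `P` can be decided in time `T`: one multi-stack Turing machine, started on the encoding of any
instance `x`, halts after at most `T x` steps with the correct answer as its output. -/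
def DecidableInTime (T : P.Instance → ℕ) : Prop :=
  ∃ M : Turing.TM2ComputableAux (Option Bool) Bool,
    (∀ k, Finite (M.tm.Γ k)) ∧
      ∀ x : P.Instance, Nonempty
        (Turing.TM2OutputsInTime M.tm ((P.encode x).map M.inputAlphabet.symm)
          (some ([decide (P.Yes x)].map M.outputAlphabet.symm)) (T x))

/-- `P/κ` is fixed-parameter tractable: it can be decided in time `f(k) * |I| ^ c`, where `k` is the
parameter, `f` is computable and `c` is a constant. -/
def IsFPT (κ : P.Instance → ℕ) : Prop :=
  ∃ (f : ℕ → ℕ) (c : ℕ), Computable f ∧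
    P.DecidableInTime fun x => f (κ x) * P.size x ^ c

/-- `P/κ` is in `XP`: it can be decided in time `f(k) * |I| ^ g(k)`, where `k` is the
parameter and `f`, `g` are computable. -/
def IsXP (κ : P.Instance → ℕ) : Prop :=
  ∃ f g : ℕ → ℕ, Computable f ∧ Computable g ∧
    P.DecidableInTime fun x => f (κ x) * P.size x ^ g (κ x)

/-- `f₁ = O*(f₂)`: there is a polynomial `p` with `f₁ I ≤ f₂ I * p |I|` for all instances `I`. -/
def IsOStar (f₁ f₂ : P.Instance → ℝ) : Prop :=
  ∃ p : Polynomial ℕ, ∀ x, f₁ x ≤ f₂ x * (p.eval (P.size x) : ℕ)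

/-- `P` can be decided in time `O*(F)`. -/
def DecidableInOStar (F : P.Instance → ℝ) : Prop :=
  ∃ T : P.Instance → ℕ, P.DecidableInTime T ∧ P.IsOStar (fun x => (T x : ℝ)) F

end DecisionProblem

/-! ### Minimal hitting sets -/

namespace Hypergraph

variable {V : Type*}

/-- `X` is a set of vertices of `H` that meets every hyperedge of `H`. -/
def IsHittingSet (H : Hypergraph V) (X : Set V) : Prop :=
  X ⊆ V(H) ∧ ∀ e ∈ E(H), (e ∩ X).Nonempty

/-- An inclusion-wise minimal hitting set. -/
def IsMinimalHittingSet (H : Hypergraph V) (X : Set V) : Prop :=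
  Minimal H.IsHittingSet X

/-- The size of a largest minimal hitting set of a finite hypergraph (`0` if there is no hitting
set, i.e. if `∅` is a hyperedge). -/
noncomputable def mmhs (H : Hypergraph V) : ℕ :=
  sSup {k | ∃ S, H.IsMinimalHittingSet S ∧ S.ncard = k}

/-- The maximum size of a hyperedge of a finite hypergraph (`0` if there is no hyperedge). -/
noncomputable def maxEdgeSize (H : Hypergraph V) : ℕ :=
  sSup (Set.ncard '' E(H))

end Hypergraph

/-! ### The problem Maximum Minimal Hitting Set -/

/-- An instance of Maximum Minimal Hitting Set: a hypergraph on the vertices `0, …, n - 1`, presented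
by a list of its hyperedges, and a positive integer `β`. -/
structure MMHSInstance where
  /-- the number of vertices -/
  n : ℕ
  /-- the hyperedges -/
  edges : List (Finset (Fin n))
  /-- the bound -/
  β : ℕ
  /-- the bound is positive -/
  β_pos : 0 < β

namespace MMHSInstance

/-- The hypergraph of an instance. -/
def hypergraph (x : MMHSInstance) : Hypergraph (Fin x.n) where
  vertexSet := Set.univ
  edgeSet := {e | ∃ f ∈ x.edges, e = (f : Set (Fin x.n))}
  subset_vertexSet_of_mem_edgeSet' := fun _ _ => Set.subset_univ _

/-- The parameter `α`: the maximum size of a hyperedge. -/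
noncomputable def α (x : MMHSInstance) : ℕ := x.hypergraph.maxEdgeSize

/-- The incidence vector of a set of vertices. -/
def row {n : ℕ} (e : Finset (Fin n)) : List Bool :=
  (List.finRange n).map fun v => decide (v ∈ e)

/-- The encoding of an instance: `β` in binary (least significant bit first), the number of vertices
in unary, and the rows of the incidence matrix, each of these followed by the separator `none`. -/
def encode (x : MMHSInstance) : List (Option Bool) :=
  (Nat.bits x.β).map some ++ none ::
    ((List.replicate x.n true).map some ++ none ::
      x.edges.flatMap fun e => (row e).map some ++ [none])

theorem map_some_append_none_inj {l₁ l₂ : List Bool} {r₁ r₂ : List (Option Bool)}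
    (h : l₁.map some ++ none :: r₁ = l₂.map some ++ none :: r₂) : l₁ = l₂ ∧ r₁ = r₂ := by
  induction l₁ generalizing l₂ with
  | nil => cases l₂ <;> simp_all
  | cons a l ih =>
    cases l₂ with
    | nil => simp at h
    | cons b l' =>
      simp only [List.map_cons, List.cons_append, List.cons.injEq, Option.some.injEq] at h
      obtain ⟨h1, h2⟩ := ih h.2
      exact ⟨by rw [h.1, h1], h2⟩

theorem bits_injective : Function.Injective Nat.bits := by
  intro a b h
  have h2 : Nat.digits 2 a = Nat.digits 2 b := by
    rw [Nat.digits_two_eq_bits, Nat.digits_two_eq_bits, h]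
  exact Nat.digits_inj_iff.1 h2

theorem row_injective {n : ℕ} : Function.Injective (row (n := n)) := by
  intro e f h
  ext v
  have := List.map_inj_left.1 h v (List.mem_finRange v)
  simpa using this

theorem rows_injective {n : ℕ} : Function.Injective
    (fun l : List (Finset (Fin n)) => l.flatMap fun e => (row e).map some ++ [none]) := by
  intro l₁
  induction l₁ with
  | nil => intro l₂ h; cases l₂ <;> simp_all
  | cons a l ih =>
    intro l₂ h
    cases l₂ with
    | nil => simp at h
    | cons b l' =>
      simp only [List.flatMap_cons, List.append_assoc, List.singleton_append] at h
      obtain ⟨h1, h2⟩ := map_some_append_none_inj h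
      rw [row_injective h1, ih h2]

theorem encode_injective : Function.Injective encode := by
  rintro ⟨n, l, b, hb⟩ ⟨n', l', b', hb'⟩ h
  obtain ⟨h1, h2⟩ := map_some_append_none_inj h
  obtain ⟨h3, h4⟩ := map_some_append_none_inj h2
  have h5 : n = n' := by simpa using congrArg List.length h3
  have h6 : b = b' := bits_injective h1
  subst h5 h6
  have h7 : l = l' := rows_injective h4
  subst h7
  rfl

end MMHSInstance

/-- The problem Maximum Minimal Hitting Set: does the given hypergraph `H` satisfy `mmhs(H) ≥ β`? -/
noncomputable def MMHS : DecisionProblem where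
  Instance := MMHSInstance
  encode := MMHSInstance.encode
  encode_injective := MMHSInstance.encode_injective
  Yes x := x.β ≤ x.hypergraph.mmhs

/-- The function `α ^ β * (c * β * log (α * β)) ^ (α * β)`, with the value `1` in the
degenerate cases `α = 0` and `α = β = 1`, where this expression is `0`. -/
noncomputable def mmhsBound (c : ℝ) (α β : ℕ) : ℝ :=
  if α * β ≤ 1 then 1
  else (α : ℝ) ^ β * (c * β * Real.log ((α : ℝ) * β)) ^ (α * β)

/-!
Let `H` be a hypergraph with `n` vertices and `m` hyperedges. The three running times come from one
search procedure with two branching rules. A node of the search tree is a set `W` of allowed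
vertices, and the root allows all vertices. At a node, `T := W` is shrunk to a minimal hitting set
`T ⊆ W` of `H`, unless `W` is no hitting set, in which case the node is discarded. If `T` has at
least `β` elements, then the answer is yes. Otherwise the search branches:

* the *vertex rule* goes on with `W \ {t}` for all `t ∈ T`, to depth `α β`;
* the *edge rule* goes on with `W \ (e \ {v})` for all hyperedges `e` and all `v ∈ e`, to depth `β`.

Soundness is clear, since `T` is always a minimal hitting set of `H`. For completeness, take `β`
elements `v` of a minimal hitting set of size at least `β`, a private hyperedge `e_v` for each of
them, and let `G` be the set of vertices outside the sets `e_v \ {v}` (`exists_guide`). Then `G` is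
a hitting set, and every hitting set `T ⊆ G` contains the chosen elements `v`, because it meets
`e_v` only in `v`. So as long as `G ⊆ W` and the search at `W` fails, we have `|T| < β`, hence `T ⊄ G`.
The vertex rule may remove an element of `T \ G`, and this can happen at most `|V \ G| ≤ α β`
times (`VertexGoal.step`). The edge rule may remove one of the at most `β` sets `e_v \ {v}` at a
time, and when all of them are gone, `W = G` (`EdgeGoal.step`).

With the vertex rule every node has at most `|T| + 1 ≤ β` children (the machine also writes a copy
of `W`, which is superfluous but harmless), which gives the time `β ^ (α β)` up to a polynomial
factor. This is `FPT` for `α + β`, and for every `c > 0` and `α β ≥ 2` it is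
`O (α ^ β (c β log (α β)) ^ (α β))`, because `c log (α β) ≥ 1` for all but finitely many pairs
(`exists_pow_le_mmhsBound`); no sunflower lemma is needed. With the edge rule every node has at most
`m (n + 1) ≤ |I|` children, which gives the time `|I| ^ (β + O(1))`.

The search is carried out by an explicit multi-stack Turing machine (`machine`). Each loop of its
program is a single label that jumps to itself, so that the correctness and the running time of
every loop is one induction over the contents of a stack. These are put together in `reaches_node`
for the visit of a node, in `search` for the depth-first search, and in `outputs` for the whole run.
-/

namespace HittingSetMachine

open Turing Turing.TM2.Stmt StateTransition

/-! ### The machine -/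

/-- A cell of the tape that carries the current node of the search tree: a vertex, with its
membership in four sets of vertices. -/
structure Cell where
  /-- the vertex is allowed in the hitting set -/
  w : Bool
  /-- the vertex belongs to the current hitting set `T`, or to the hyperedge that is branched on -/
  t : Bool
  /-- the vertex is the only element of `T` in some hyperedge scanned so far -/
  p : Bool
  /-- scratch mark -/
  q : Bool
deriving DecidableEq, Fintype

/-- The symbols on the agenda of the depth-first search. From the top of the stack, a node is
written as `beg`, a `vert` for each vertex in reverse order, and `fin`; the symbol `ret` marks the
point where the search leaves a subtree and the remaining depth goes up again. -/
inductive Item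
  | vert (w : Bool)
  | fin
  | beg
  | ret
deriving DecidableEq, Fintype

/-- The names of the stacks. -/
inductive Stk
  | inp | out | seen | bin | cap | bet | bet' | alp | alp' | dep | dep' | cur | cur' | agenda
deriving DecidableEq

instance : Fintype Stk where
  elems := {.inp, .out, .seen, .bin, .cap, .bet, .bet', .alp, .alp', .dep, .dep', .cur, .cur',
    .agenda}
  complete k := by cases k <;> decide

/-- The stack alphabets. -/
abbrev Γ : Stk → Type
  | .inp | .seen => Option Bool
  | .out | .bin => Bool
  | .cap | .bet | .bet' | .alp | .alp' | .dep | .dep' => Unit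
  | .cur | .cur' => Cell
  | .agenda => Item

/-- The contents of the stacks. Unary numbers are kept as the lengths of lists. -/
structure Stacks where
  /-- the rest of the input, which ends up as the rows of the incidence matrix -/
  inp : List (Option Bool) := []
  /-- the output -/
  out : List Bool := []
  /-- the part of the rows that has been scanned -/
  seen : List (Option Bool) := []
  /-- the binary digits of `β`, most significant digit on top -/
  bin : List Bool := []
  /-- how far the unary copy of `β` may still grow -/
  cap : List Unit := []
  /-- `min β (n + 1)` in unary -/
  bet : List Unit := []
  /-- the part of `bet` that has been read -/
  bet' : List Unit := []
  /-- the largest size of a row seen so far -/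
  alp : List Unit := []
  /-- the part of `alp` that has been read -/
  alp' : List Unit := []
  /-- the remaining depth of the search -/
  dep : List Unit := []
  /-- the depth that has been used up -/
  dep' : List Unit := []
  /-- the cells of the current node -/
  cur : List Cell := []
  /-- the part of `cur` that has been read -/
  cur' : List Cell := []
  /-- the nodes that are still to be visited -/
  agenda : List Item := []

namespace Stacks

/-- The contents of the stack `k`. -/
def get (s : Stacks) : ∀ k, List (Γ k)
  | .inp => s.inp
  | .out => s.out
  | .seen => s.seen
  | .bin => s.bin
  | .cap => s.cap
  | .bet => s.bet
  | .bet' => s.bet'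
  | .alp => s.alp
  | .alp' => s.alp'
  | .dep => s.dep
  | .dep' => s.dep'
  | .cur => s.cur
  | .cur' => s.cur'
  | .agenda => s.agenda

/-- Replace the contents of the stack `k`. -/
def set (s : Stacks) : ∀ k, List (Γ k) → Stacks
  | .inp, l => { s with inp := l }
  | .out, l => { s with out := l }
  | .seen, l => { s with seen := l }
  | .bin, l => { s with bin := l }
  | .cap, l => { s with cap := l }
  | .bet, l => { s with bet := l }
  | .bet', l => { s with bet' := l }
  | .alp, l => { s with alp := l }
  | .alp', l => { s with alp' := l }
  | .dep, l => { s with dep := l }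
  | .dep', l => { s with dep' := l }
  | .cur, l => { s with cur := l }
  | .cur', l => { s with cur' := l }
  | .agenda, l => { s with agenda := l }

theorem get_set (s : Stacks) (k : Stk) (l : List (Γ k)) :
    (s.set k l).get = Function.update s.get k l := by
  funext j
  cases k <;> cases j <;> rfl

end Stacks

/-- The part of the internal state that is kept between two steps. -/
structure Flags where
  /-- the number of elements of `T` in the hyperedge that is scanned, where `2` means "at least 2"
  -/
  cnt : Fin 3 := 0
  /-- some hyperedge is disjoint from `T` -/
  dead : Bool := false
  /-- a minimal hitting set of the required size has been found -/
  acc : Bool := false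
  /-- multi-purpose bit -/
  flag : Bool := false
deriving DecidableEq, Fintype

/-- The internal states: the flags, and the symbols that are popped in the course of one step. -/
structure Reg where
  /-- the flags -/
  flags : Flags := {}
  /-- a symbol of `inp` or `seen` -/
  sym : Option (Option Bool) := none
  /-- a symbol of `bin` -/
  bit : Option Bool := none
  /-- a cell -/
  cell : Option Cell := none
  /-- a symbol of the agenda -/
  item : Option Item := none
  /-- whether the last pop from a unary number succeeded -/
  one : Bool := false
deriving DecidableEq, Fintype

/-- The internal state in which nothing has been popped. -/
def Flags.toReg (f : Flags) : Reg := { flags := f }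

/-- The labels of the program. Every loop over the contents of a stack is a single label that jumps
to itself. The labels up to `multBack` prepare the search; `pick` and `unpack` take a node from the
agenda; the labels from `scan` to `shrinkBack` find a minimal hitting set, `count` compares its size
with `β`, and the labels from `expand` to `maskRewind` write the children; `discard` ends the visit
of a node, and `clean` ends the computation. -/
inductive Lab
  | readBeta | readVerts | horner | double | doubleBack
  | maxRow | maxRowMove | maxRowBack | maxRowRewind | mult | multAdd | multBack
  | pick | unpack | scan | mark | scanRewind | shrink | shrinkBack | count | countBack
  | expand | child | childBack | maskRow | maskRewind | discard | clean
deriving DecidableEq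

instance : Fintype Lab where
  elems := {.readBeta, .readVerts, .horner, .double, .doubleBack, .maxRow, .maxRowMove,
    .maxRowBack, .maxRowRewind, .mult, .multAdd, .multBack, .pick, .unpack, .scan, .mark,
    .scanRewind, .shrink, .shrinkBack, .count, .countBack, .expand, .child, .childBack, .maskRow,
    .maskRewind, .discard, .clean}
  complete l := by cases l <;> decide

/-- The statements of the machine. -/
abbrev Code := TM2.Stmt Γ Lab Reg

/-- End the step and jump to `l`. -/
def go (l : Lab) : Code := load (fun r => r.flags.toReg) (goto fun _ => l)

/-- Change the flags. -/
def setFlags (f : Reg → Flags) (c : Code) : Code := load (fun r => { r with flags := f r }) c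

/-- Pop an input symbol; continue with `c₁` on success and with `c₂` on the empty stack. -/
def popInp (c₁ c₂ : Code) : Code :=
  pop .inp (fun r o => { r with sym := o }) (branch (fun r => r.sym.isSome) c₁ c₂)

/-- Pop a cell of the current node. -/
def popCur (c₁ c₂ : Code) : Code :=
  pop .cur (fun r o => { r with cell := o }) (branch (fun r => r.cell.isSome) c₁ c₂)

/-- Branch on the success of the preceding pop from a unary number. -/
def ifOne (c₁ c₂ : Code) : Code := branch (fun r => r.one) c₁ c₂

/-- The bit that has been read from `inp`. -/
def Reg.symBit (r : Reg) : Bool := (r.sym.getD none).getD false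

/-- Whether the symbol that has been read from `inp` is a bit. -/
def Reg.isBit (r : Reg) : Bool := (r.sym.getD none).isSome

/-- The cell that has been read. -/
def Reg.theCell (r : Reg) : Cell := r.cell.getD ⟨false, false, false, false⟩

/-- Counting with the values `0`, `1` and "at least 2". -/
def bump (c : Fin 3) : Fin 3 := if c = 0 then 1 else 2

/-- The cell is the next one to be removed from `T`: it is in `T`, has no private hyperedge, and no
cell has been removed in this round. -/
def Reg.removable (r : Reg) : Bool := r.theCell.t && !r.theCell.p && !r.flags.flag

/-- The cell is the next one to be branched on. -/
def Reg.selected (r : Reg) : Bool := r.theCell.t && !r.theCell.q && !r.flags.flag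

/-- Whether a vertex is allowed in the child that is being written. With `xp = false`, the selected
vertex is removed; with `xp = true`, all marked vertices but the selected one are removed. -/
def childBit (xp w t sel : Bool) : Bool := w && if xp then !t || sel else !sel

/-- The program. The parameter `xp` chooses between the vertex rule (`false`), which gives the `FPT`
algorithm, and the edge rule (`true`), which gives the `XP` algorithm. -/
def prog (xp : Bool) : Lab → Code
  | .readBeta => popInp
      (branch Reg.isBit (push .bin Reg.symBit (go .readBeta))
        (push .agenda (fun _ => .fin) (go .readVerts)))
      (go .readVerts)
  | .readVerts => popInp
      (branch Reg.isBit
        (push .cap (fun _ => ()) (push .agenda (fun _ => .vert true) (go .readVerts)))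
        (push .cap (fun _ => ()) (push .agenda (fun _ => .beg)
          (if xp then push .alp (fun _ => ()) (go .horner) else go .horner))))
      (go .horner)
  | .horner => pop .bin (fun r o => { r with bit := o }) (branch (fun r => r.bit.isSome)
      (setFlags (fun r => { r.flags with flag := r.bit.getD false }) (go .double))
      (if xp then go .mult else go .maxRow))
  | .double => pop .bet (fun r o => { r with one := o.isSome }) (ifOne
      (push .bet' (fun _ => ()) (pop .cap (fun r o => { r with one := o.isSome })
        (ifOne (push .bet' (fun _ => ()) (go .double)) (go .double))))
      (branch (fun r => r.flags.flag)
        (setFlags (fun r => { r.flags with flag := false })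
          (pop .cap (fun r o => { r with one := o.isSome })
            (ifOne (push .bet' (fun _ => ()) (go .doubleBack)) (go .doubleBack))))
        (go .doubleBack)))
  | .doubleBack => pop .bet' (fun r o => { r with one := o.isSome })
      (ifOne (push .bet (fun _ => ()) (go .doubleBack)) (go .horner))
  | .maxRow => popInp
      (push .seen (fun r => r.sym.getD none) (branch Reg.isBit
        (branch Reg.symBit
          (pop .alp (fun r _ => r) (push .alp' (fun _ => ()) (go .maxRow)))
          (go .maxRow))
        (go .maxRowMove)))
      (go .maxRowRewind)
  | .maxRowMove => pop .alp (fun r o => { r with one := o.isSome })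
      (ifOne (push .alp' (fun _ => ()) (go .maxRowMove)) (go .maxRowBack))
  | .maxRowBack => pop .alp' (fun r o => { r with one := o.isSome })
      (ifOne (push .alp (fun _ => ()) (go .maxRowBack)) (go .maxRow))
  | .maxRowRewind => pop .seen (fun r o => { r with sym := o }) (branch (fun r => r.sym.isSome)
      (push .inp (fun r => r.sym.getD none) (go .maxRowRewind)) (go .mult))
  | .mult => pop .alp (fun r o => { r with one := o.isSome }) (ifOne (go .multAdd) (go .pick))
  | .multAdd => pop .bet (fun r o => { r with one := o.isSome })
      (ifOne (push .bet' (fun _ => ()) (push .dep (fun _ => ()) (go .multAdd))) (go .multBack))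
  | .multBack => pop .bet' (fun r o => { r with one := o.isSome })
      (ifOne (push .bet (fun _ => ()) (go .multBack)) (go .mult))
  | .pick => pop .agenda (fun r o => { r with item := o })
      (branch (fun r => r.item = some .ret)
        (pop .dep' (fun r _ => r) (push .dep (fun _ => ()) (go .pick)))
        (branch (fun r => r.item = some .beg) (go .unpack) (go .clean)))
  | .unpack => pop .agenda (fun r o => { r with item := o })
      (branch (fun r => r.item = some (.vert true))
        (push .cur (fun _ => ⟨true, true, false, false⟩) (go .unpack))
        (branch (fun r => r.item = some (.vert false))
          (push .cur (fun _ => ⟨false, false, false, false⟩) (go .unpack))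
          (go .scan)))
  | .scan => popInp
      (push .seen (fun r => r.sym.getD none) (branch Reg.isBit
        (pop .cur (fun r o => { r with cell := o })
          (push .cur' (fun r => { r.theCell with q := r.symBit && r.theCell.t })
            (setFlags (fun r => { r.flags with
                cnt := if r.symBit && r.theCell.t then bump r.flags.cnt else r.flags.cnt })
              (go .scan))))
        (setFlags (fun r => { r.flags with dead := r.flags.dead || r.flags.cnt = 0 }) (go .mark))))
      (go .scanRewind)
  | .mark => pop .cur' (fun r o => { r with cell := o }) (branch (fun r => r.cell.isSome)
      (push .cur (fun r => { r.theCell with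
          p := r.theCell.p || r.theCell.q && r.flags.cnt = 1 }) (go .mark))
      (setFlags (fun r => { r.flags with cnt := 0 }) (go .scan)))
  | .scanRewind => pop .seen (fun r o => { r with sym := o }) (branch (fun r => r.sym.isSome)
      (push .inp (fun r => r.sym.getD none) (go .scanRewind))
      (branch (fun r => r.flags.dead)
        (setFlags (fun r => { r.flags with dead := false }) (go .discard))
        (go .shrink)))
  | .shrink => popCur
      (push .cur' (fun r => { r.theCell with t := r.theCell.t && !r.removable, p := false })
        (setFlags (fun r => { r.flags with flag := r.flags.flag || r.removable }) (go .shrink)))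
      (go .shrinkBack)
  | .shrinkBack => pop .cur' (fun r o => { r with cell := o }) (branch (fun r => r.cell.isSome)
      (push .cur Reg.theCell (go .shrinkBack))
      (branch (fun r => r.flags.flag)
        (setFlags (fun r => { r.flags with flag := false }) (go .scan))
        (go .count)))
  | .count => popCur
      (push .cur' (fun r => { r.theCell with q := false }) (branch (fun r => r.theCell.t)
        (pop .bet (fun r o => { r with one := o.isSome })
          (ifOne (push .bet' (fun _ => ()) (go .count)) (go .count)))
        (go .count)))
      (peek .bet (fun r o => { r with one := o.isSome }) (ifOne (go .countBack)
        (setFlags (fun r => { r.flags with acc := true }) (go .clean))))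
  | .countBack => pop .bet' (fun r o => { r with one := o.isSome })
      (ifOne (push .bet (fun _ => ()) (go .countBack)) (go .expand))
  | .expand => pop .dep (fun r o => { r with one := o.isSome }) (ifOne
      (push .dep' (fun _ => ()) (push .agenda (fun _ => .ret)
        (setFlags (fun r => { r.flags with flag := !xp }) (go .childBack))))
      (go .discard))
  | .child => popCur
      (push .agenda (fun r => .vert (childBit xp r.theCell.w r.theCell.t r.selected))
        (push .cur' (fun r => { r.theCell with q := r.theCell.q || r.selected })
          (setFlags (fun r => { r.flags with flag := r.flags.flag || r.selected }) (go .child))))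
      (push .agenda (fun _ => .beg) (go .childBack))
  | .childBack => pop .cur' (fun r o => { r with cell := o }) (branch (fun r => r.cell.isSome)
      (push .cur Reg.theCell (go .childBack))
      (branch (fun r => r.flags.flag)
        (setFlags (fun r => { r.flags with flag := false })
          (push .agenda (fun _ => .fin) (go .child)))
        (if xp then go .maskRow else go .discard)))
  | .maskRow => popInp
      (push .seen (fun r => r.sym.getD none) (branch Reg.isBit
        (pop .cur (fun r o => { r with cell := o })
          (push .cur' (fun r => { r.theCell with t := r.symBit, q := false }) (go .maskRow)))
        (setFlags (fun r => { r.flags with flag := true }) (go .childBack))))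
      (go .maskRewind)
  | .maskRewind => pop .seen (fun r o => { r with sym := o }) (branch (fun r => r.sym.isSome)
      (push .inp (fun r => r.sym.getD none) (go .maskRewind)) (go .discard))
  | .discard => popCur (go .discard)
      (pop .cur' (fun r o => { r with cell := o }) (branch (fun r => r.cell.isSome)
        (go .discard) (go .pick)))
  | .clean =>
      pop .inp (fun r o => { r with one := r.one || o.isSome }) <|
      pop .seen (fun r o => { r with one := r.one || o.isSome }) <|
      pop .bin (fun r o => { r with one := r.one || o.isSome }) <|
      pop .cap (fun r o => { r with one := r.one || o.isSome }) <|
      pop .bet (fun r o => { r with one := r.one || o.isSome }) <|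
      pop .bet' (fun r o => { r with one := r.one || o.isSome }) <|
      pop .alp (fun r o => { r with one := r.one || o.isSome }) <|
      pop .alp' (fun r o => { r with one := r.one || o.isSome }) <|
      pop .dep (fun r o => { r with one := r.one || o.isSome }) <|
      pop .dep' (fun r o => { r with one := r.one || o.isSome }) <|
      pop .cur (fun r o => { r with one := r.one || o.isSome }) <|
      pop .cur' (fun r o => { r with one := r.one || o.isSome }) <|
      pop .agenda (fun r o => { r with one := r.one || o.isSome }) <|
      ifOne (go .clean) (push .out (fun r => r.flags.acc) (load (fun _ => {}) halt))

/-- The machine with the branching rule `xp`. -/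
def machine (xp : Bool) : FinTM2 where
  K := Stk
  k₀ := .inp
  k₁ := .out
  Γ := Γ
  Λ := Lab
  main := .readBeta
  σ := Reg
  initialState := {}
  Γk₀Fin := inferInstanceAs (Fintype (Option Bool))
  m := prog xp

/-! ### Running the machine -/

/-- The effect of a statement on an internal state and on stacks given as a `Stacks`. -/
def exec : Code → Reg → Stacks → Option Lab × Reg × Stacks
  | push k f q, r, s => exec q r (s.set k (f r :: s.get k))
  | peek k f q, r, s => exec q (f r (s.get k).head?) s
  | pop k f q, r, s => exec q (f r (s.get k).head?) (s.set k (s.get k).tail)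
  | load a q, r, s => exec q (a r) s
  | branch f q₁ q₂, r, s => cond (f r) (exec q₁ r s) (exec q₂ r s)
  | goto f, r, s => (some (f r), r, s)
  | halt, r, s => (none, r, s)

/-- The machine configuration that is described by its three components. -/
def cfg (xp : Bool) (c : Option Lab × Reg × Stacks) : (machine xp).Cfg := ⟨c.1, c.2.1, c.2.2.get⟩

theorem stepAux_get (q : Code) (r : Reg) (s : Stacks) :
    TM2.stepAux q r s.get =
      ⟨(exec q r s).1, (exec q r s).2.1, (exec q r s).2.2.get⟩ := by
  induction q generalizing r s with
  | push k f q ih => simp only [TM2.stepAux, exec, ← Stacks.get_set, ih]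
  | peek k f q ih => simp only [TM2.stepAux, exec, ih]
  | pop k f q ih => simp only [TM2.stepAux, exec, ← Stacks.get_set, ih]
  | load a q ih => simp only [TM2.stepAux, exec, ih]
  | branch f q₁ q₂ ih₁ ih₂ =>
    simp only [TM2.stepAux, exec]
    cases f r <;> simp only [cond, ih₁, ih₂]
  | goto f => rfl
  | halt => rfl

/-- The points of a run between two steps: a label, the flags and the stacks. -/
abbrev Point := Lab × Flags × Stacks

/-- The configuration at a point of a run. -/
def Point.cfg (xp : Bool) (c : Point) : (machine xp).Cfg :=
  HittingSetMachine.cfg xp (some c.1, c.2.1.toReg, c.2.2)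

/-- The machine gets from the point `c` to the point `d` in at most `t` steps. -/
def Reaches (xp : Bool) (t : ℕ) (c d : Point) : Prop :=
  Nonempty (EvalsToInTime (machine xp).step (c.cfg xp) (some (d.cfg xp)) t)

variable {xp : Bool} {ι : Type*} {n : ℕ}

theorem Reaches.refl {t : ℕ} (c : Point) : Reaches xp t c c :=
  ⟨⟨⟨0, rfl⟩, Nat.zero_le _⟩⟩

theorem Reaches.trans {t₁ t₂ : ℕ} {c d e : Point} (h₁ : Reaches xp t₁ c d)
    (h₂ : Reaches xp t₂ d e) : Reaches xp (t₁ + t₂) c e := by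
  obtain ⟨h₁⟩ := h₁
  obtain ⟨h₂⟩ := h₂
  exact ⟨Nat.add_comm t₁ t₂ ▸ EvalsToInTime.trans _ _ _ _ _ _ h₁ h₂⟩

theorem Reaches.mono {t₁ t₂ : ℕ} {c d : Point} (h : Reaches xp t₁ c d) (ht : t₁ ≤ t₂) :
    Reaches xp t₂ c d := by
  obtain ⟨h⟩ := h
  exact ⟨⟨h.toEvalsTo, h.steps_le_m.trans ht⟩⟩

theorem Reaches.single {l l' : Lab} {f f' : Flags} {s s' : Stacks}
    (h : exec (prog xp l) f.toReg s = (some l', f'.toReg, s')) :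
    Reaches xp 1 (l, f, s) (l', f', s') := by
  refine ⟨⟨⟨1, ?_⟩, le_rfl⟩⟩
  change some (TM2.stepAux (prog xp l) f.toReg s.get) = _
  rw [stepAux_get, h]
  rfl

theorem Reaches.head {t : ℕ} {l l' : Lab} {f f' : Flags} {s s' : Stacks} {c : Point}
    (h : exec (prog xp l) f.toReg s = (some l', f'.toReg, s'))
    (h' : Reaches xp t (l', f', s') c) : Reaches xp (t + 1) (l, f, s) c := by
  rw [Nat.add_comm]
  exact (Reaches.single h).trans h'

/-! ### Preparing the search: `β` in unary, and the depth -/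

/-- A unary number. -/
abbrev U (k : ℕ) : List Unit := List.replicate k ()

theorem reaches_doubleBack (f : Flags) (s : Stacks) (a b : ℕ) :
    Reaches xp (a + 1) (.doubleBack, f, { s with bet' := U a, bet := U b })
      (.horner, f, { s with bet' := [], bet := U (b + a) }) := by
  induction a generalizing b with
  | zero => exact .single rfl
  | succ a ih =>
    have h := ih (b + 1)
    rw [Nat.add_right_comm] at h
    exact .head rfl h

theorem reaches_multBack (f : Flags) (s : Stacks) (a b : ℕ) :
    Reaches xp (a + 1) (.multBack, f, { s with bet' := U a, bet := U b })
      (.mult, f, { s with bet' := [], bet := U (b + a) }) := by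
  induction a generalizing b with
  | zero => exact .single rfl
  | succ a ih =>
    have h := ih (b + 1)
    rw [Nat.add_right_comm] at h
    exact .head rfl h

theorem reaches_countBack (f : Flags) (s : Stacks) (a b : ℕ) :
    Reaches xp (a + 1) (.countBack, f, { s with bet' := U a, bet := U b })
      (.expand, f, { s with bet' := [], bet := U (b + a) }) := by
  induction a generalizing b with
  | zero => exact .single rfl
  | succ a ih =>
    have h := ih (b + 1)
    rw [Nat.add_right_comm] at h
    exact .head rfl h

theorem reaches_maxRowMove (f : Flags) (s : Stacks) (a b : ℕ) :
    Reaches xp (a + 1) (.maxRowMove, f, { s with alp := U a, alp' := U b })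
      (.maxRowBack, f, { s with alp := [], alp' := U (b + a) }) := by
  induction a generalizing b with
  | zero => exact .single rfl
  | succ a ih =>
    have h := ih (b + 1)
    rw [Nat.add_right_comm] at h
    exact .head rfl h

theorem reaches_maxRowBack (f : Flags) (s : Stacks) (a b : ℕ) :
    Reaches xp (a + 1) (.maxRowBack, f, { s with alp' := U a, alp := U b })
      (.maxRow, f, { s with alp' := [], alp := U (b + a) }) := by
  induction a generalizing b with
  | zero => exact .single rfl
  | succ a ih =>
    have h := ih (b + 1)
    rw [Nat.add_right_comm] at h
    exact .head rfl h

theorem reaches_multAdd (f : Flags) (s : Stacks) (a b d : ℕ) :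
    Reaches xp (a + 1) (.multAdd, f, { s with bet := U a, bet' := U b, dep := U d })
      (.multBack, f, { s with bet := [], bet' := U (b + a), dep := U (d + a) }) := by
  induction a generalizing b d with
  | zero => exact .single rfl
  | succ a ih =>
    have h := ih (b + 1) (d + 1)
    rw [Nat.add_right_comm, Nat.add_right_comm d] at h
    exact .head rfl h

theorem reaches_maxRowRewind (f : Flags) (s : Stacks) (l r : List (Option Bool)) :
    Reaches xp (l.length + 1) (.maxRowRewind, f, { s with seen := l, inp := r })
      (.mult, f, { s with seen := [], inp := l.reverse ++ r }) := by
  induction l generalizing r with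
  | nil => exact .single rfl
  | cons x l ih =>
    have h := ih (x :: r)
    rw [List.reverse_cons, List.append_assoc]
    exact .head rfl h

theorem reaches_maskRewind (f : Flags) (s : Stacks) (l r : List (Option Bool)) :
    Reaches xp (l.length + 1) (.maskRewind, f, { s with seen := l, inp := r })
      (.discard, f, { s with seen := [], inp := l.reverse ++ r }) := by
  induction l generalizing r with
  | nil => exact .single rfl
  | cons x l ih =>
    have h := ih (x :: r)
    rw [List.reverse_cons, List.append_assoc]
    exact .head rfl h

theorem reaches_scanRewind (f : Flags) (s : Stacks) (l r : List (Option Bool)) :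
    Reaches xp (l.length + 1) (.scanRewind, f, { s with seen := l, inp := r })
      (if f.dead then .discard else .shrink, { f with dead := false },
        { s with seen := [], inp := l.reverse ++ r }) := by
  induction l generalizing r with
  | nil =>
    obtain ⟨cnt, dead, acc, flag⟩ := f
    cases dead <;> exact .single rfl
  | cons x l ih =>
    have h := ih (x :: r)
    rw [List.reverse_cons, List.append_assoc]
    exact .head rfl h

theorem reaches_readBeta (f : Flags) (s : Stacks) (l b : List Bool) (r : List (Option Bool)) :
    Reaches xp (l.length + 1) (.readBeta, f, { s with inp := l.map some ++ none :: r, bin := b })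
      (.readVerts, f, { s with inp := r, bin := l.reverse ++ b, agenda := .fin :: s.agenda }) := by
  induction l generalizing b with
  | nil => exact .single rfl
  | cons x l ih =>
    have h := ih (x :: b)
    rw [List.reverse_cons, List.append_assoc]
    exact .head rfl h

theorem reaches_readVerts (f : Flags) (s : Stacks) (n k a : ℕ) (g : List Item)
    (r : List (Option Bool)) :
    Reaches xp (n + 1)
      (.readVerts, f, { s with
        inp := (List.replicate n true).map some ++ none :: r, cap := U k, alp := U a, agenda := g })
      (.horner, f, { s with
        inp := r, cap := U (k + n + 1), alp := U (a + xp.toNat),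
        agenda := .beg :: (List.replicate n (.vert true) ++ g) }) := by
  induction n generalizing k g with
  | zero => cases xp <;> exact .single rfl
  | succ n ih =>
    have h := ih (k + 1) (.vert true :: g)
    rw [Nat.add_right_comm k, List.append_cons (List.replicate n (Item.vert true)),
      ← List.replicate_succ'] at h
    exact .head rfl h

/-- Doubling is cut off when `cap` is exhausted. -/
theorem reaches_double (f : Flags) (s : Stacks) (x : Bool) (a b c : ℕ) :
    Reaches xp (a + 1)
      (.double, { f with flag := x }, { s with bet := U a, bet' := U b, cap := U c })
      (.doubleBack, { f with flag := false }, { s with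
        bet := [], bet' := U (b + a + min (a + x.toNat) c), cap := U (c - (a + x.toNat)) }) := by
  induction a generalizing b c with
  | zero => cases x <;> cases c <;> exact .single rfl
  | succ a ih =>
    cases c with
    | zero =>
      have h := ih (b + 1) 0
      rw [Nat.zero_sub, Nat.min_zero, Nat.add_right_comm b 1 a] at h
      rw [Nat.zero_sub, Nat.min_zero]
      exact .head rfl h
    | succ c =>
      have h := ih (b + 2) c
      rw [show b + 2 + a + min (a + x.toNat) c =
          b + (a + 1) + min (a + 1 + x.toNat) (c + 1) by omega,
        show c - (a + x.toNat) = c + 1 - (a + 1 + x.toNat) by omega] at h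
      exact .head rfl h

/-- The value of a binary number, most significant digit first, with initial value `u`. -/
def hornerValue (u : ℕ) (l : List Bool) : ℕ := l.foldl (fun u b => 2 * u + b.toNat) u

/-- Horner's rule, cut off at `M`. -/
theorem reaches_horner (f : Flags) (s : Stacks) (l : List Bool) (u M : ℕ) :
    Reaches xp (l.length * (2 * M + 3) + 1)
      (.horner, { f with flag := false },
        { s with bin := l, bet := U (min u M), bet' := [], cap := U (M - u) })
      (if xp then .mult else .maxRow, { f with flag := false },
        { s with bin := [], bet := U (min (hornerValue u l) M), bet' := [],
                 cap := U (M - hornerValue u l) }) := by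
  induction l generalizing u with
  | nil =>
    refine .mono ?_ (Nat.le_add_left 1 _)
    cases xp <;> exact .single rfl
  | cons x l ih =>
    have h₁ := reaches_double (xp := xp) f { s with bin := l } x (min u M) 0 (M - u)
    have h₂ := reaches_doubleBack (xp := xp) { f with flag := false }
      { s with bin := l, cap := U (M - (2 * u + x.toNat)) } (min (2 * u + x.toNat) M) 0
    rw [show 0 + min u M + min (min u M + x.toNat) (M - u) = min (2 * u + x.toNat) M by omega,
      show M - u - (min u M + x.toNat) = M - (2 * u + x.toNat) by omega] at h₁
    rw [Nat.zero_add] at h₂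
    refine .mono (.head rfl ((h₁.trans h₂).trans (ih (2 * u + x.toNat)))) ?_
    rw [List.length_cons, Nat.succ_mul l.length]
    omega

/-- Counting the elements of a row: `alp` goes down and `alp'` goes up. -/
theorem reaches_maxRow (f : Flags) (s : Stacks) (vs : List ι) (e : ι → Bool)
    (r q : List (Option Bool)) (a b : ℕ) :
    Reaches xp (vs.length + 1)
      (.maxRow, f, { s with
        inp := vs.map (fun v => some (e v)) ++ none :: r, seen := q, alp := U a, alp' := U b })
      (.maxRowMove, f, { s with
        inp := r, seen := none :: ((vs.map (fun v => some (e v))).reverse ++ q),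
        alp := U (a - vs.countP e), alp' := U (b + vs.countP e) }) := by
  induction vs generalizing q a b with
  | nil => exact .single rfl
  | cons v vs ih =>
    simp only [List.map_cons, List.reverse_cons, List.append_assoc, List.cons_append]
    cases hv : e v with
    | false =>
      rw [List.countP_cons_of_neg (by simp [hv])]
      exact .head rfl (ih _ _ _)
    | true =>
      have h := ih (some true :: q) (a - 1) (b + 1)
      rw [List.countP_cons_of_pos hv,
        show a - (vs.countP e + 1) = a - 1 - vs.countP e by omega,
        show b + (vs.countP e + 1) = b + 1 + vs.countP e by omega]
      cases a <;> exact .head rfl h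

/-- The rows of an incidence matrix, as they are written in the input. -/
def rowCode (vs : List ι) (rows : List (ι → Bool)) : List (Option Bool) :=
  rows.flatMap fun e => vs.map (fun v => some (e v)) ++ [none]

theorem rowCode_cons (vs : List ι) (e : ι → Bool) (rows : List (ι → Bool)) :
    rowCode vs (e :: rows) = vs.map (fun v => some (e v)) ++ none :: rowCode vs rows := by
  simp [rowCode]

/-- The largest number of elements in a row, and at least `a`. -/
def maxCount (vs : List ι) (a : ℕ) (rows : List (ι → Bool)) : ℕ :=
  rows.foldl (fun a e => max a (vs.countP e)) a

theorem reaches_maxRows (f : Flags) (s : Stacks) (vs : List ι) (rows : List (ι → Bool))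
    (q : List (Option Bool)) (a : ℕ) (ha : a ≤ vs.length) :
    Reaches xp (rows.length * (3 * vs.length + 3) + 1)
      (.maxRow, f, { s with inp := rowCode vs rows, seen := q, alp := U a, alp' := [] })
      (.maxRowRewind, f, { s with
        inp := [], seen := (rowCode vs rows).reverse ++ q, alp := U (maxCount vs a rows),
        alp' := [] }) := by
  induction rows generalizing q a with
  | nil =>
    refine .mono ?_ (Nat.le_add_left 1 _)
    exact .single rfl
  | cons e rows ih =>
    have hk : vs.countP e ≤ vs.length := List.countP_le_length
    have h₁ := reaches_maxRow (xp := xp) f s vs e (rowCode vs rows) q a 0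
    have h₂ := reaches_maxRowMove (xp := xp) f
      { s with inp := rowCode vs rows, seen := none :: ((vs.map fun v => some (e v)).reverse ++ q) }
      (a - vs.countP e) (0 + vs.countP e)
    have h₃ := reaches_maxRowBack (xp := xp) f
      { s with inp := rowCode vs rows, seen := none :: ((vs.map fun v => some (e v)).reverse ++ q) }
      (0 + vs.countP e + (a - vs.countP e)) 0
    have h₄ := ih (none :: ((vs.map fun v => some (e v)).reverse ++ q)) (max a (vs.countP e))
      (max_le ha hk)
    rw [show 0 + (0 + vs.countP e + (a - vs.countP e)) = max a (vs.countP e) by omega] at h₃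
    have h := ((h₁.trans h₂).trans h₃).trans h₄
    rw [rowCode_cons]
    simp only [List.reverse_append, List.reverse_cons, List.append_assoc, List.singleton_append]
    refine h.mono ?_
    rw [List.length_cons, Nat.succ_mul rows.length]
    omega

theorem reaches_mult (f : Flags) (s : Stacks) (a b d : ℕ) :
    Reaches xp (a * (2 * b + 3) + 1)
      (.mult, f, { s with alp := U a, bet := U b, bet' := [], dep := U d })
      (.pick, f, { s with alp := [], bet := U b, bet' := [], dep := U (d + a * b) }) := by
  induction a generalizing d with
  | zero =>
    refine .mono ?_ (Nat.le_add_left 1 _)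
    rw [Nat.zero_mul]
    exact .single rfl
  | succ a ih =>
    have h₁ := reaches_multAdd (xp := xp) f { s with alp := U a } b 0 d
    have h₂ := reaches_multBack (xp := xp) f { s with alp := U a, dep := U (d + b) } b 0
    have h₃ := ih (d + b)
    rw [Nat.zero_add] at h₁ h₂
    rw [show d + b + a * b = d + (a + 1) * b by ring] at h₃
    refine .mono (.head rfl ((h₁.trans h₂).trans h₃)) ?_
    rw [Nat.succ_mul a]
    omega

/-! ### Shrinking `T` to a minimal hitting set -/

theorem iterate_bump_eq_zero (k : ℕ) : bump^[k] 0 = 0 ↔ k = 0 := by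
  induction k with
  | zero => simp
  | succ k ih =>
    rw [Function.iterate_succ_apply']
    generalize bump^[k] 0 = x
    revert x
    simp [bump]
    decide

theorem iterate_bump_eq_one (k : ℕ) : bump^[k] 0 = 1 ↔ k = 1 := by
  cases k with
  | zero => simp
  | succ k =>
    rw [Function.iterate_succ_apply', Nat.add_eq_right, ← iterate_bump_eq_zero]
    generalize bump^[k] 0 = x
    revert x
    decide

theorem reaches_scan (f : Flags) (s : Stacks) (vs : List ι) (e : ι → Bool) (c : ι → Cell)
    (r q : List (Option Bool)) (l : List Cell) :
    Reaches xp (vs.length + 1)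
      (.scan, f, { s with
        inp := vs.map (fun v => some (e v)) ++ none :: r, seen := q, cur := vs.map c, cur' := l })
      (.mark, { f with
          cnt := bump^[vs.countP fun v => e v && (c v).t] f.cnt,
          dead := f.dead || decide (bump^[vs.countP fun v => e v && (c v).t] f.cnt = 0) },
        { s with
          inp := r, seen := none :: ((vs.map (fun v => some (e v))).reverse ++ q), cur := [],
          cur' := (vs.map fun v => { c v with q := e v && (c v).t }).reverse ++ l }) := by
  induction vs generalizing f q l with
  | nil => exact .single rfl
  | cons v vs ih =>
    simp only [List.map_cons, List.reverse_cons, List.append_assoc, List.cons_append]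
    cases hv : e v && (c v).t with
    | false =>
      rw [List.countP_cons_of_neg (by simp [hv])]
      have h := ih f (some (e v) :: q) ({ c v with q := e v && (c v).t } :: l)
      rw [hv] at h
      refine .head ?_ h
      simp only [exec, prog, popInp, go, Stacks.get, Stacks.set, List.head?, List.tail, setFlags,
        Reg.theCell, Reg.symBit, Reg.isBit, Option.isSome, cond, Option.getD, hv, Flags.toReg]
      rfl
    | true =>
      rw [List.countP_cons_of_pos (p := fun v => e v && (c v).t) hv]
      have h := ih { f with cnt := bump f.cnt } (some (e v) :: q)
        ({ c v with q := e v && (c v).t } :: l)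
      rw [hv] at h
      refine .head ?_ h
      simp only [exec, prog, popInp, go, Stacks.get, Stacks.set, List.head?, List.tail, setFlags,
        Reg.theCell, Reg.symBit, Reg.isBit, Option.isSome, cond, Option.getD, hv, Flags.toReg]
      rfl

theorem reaches_mark (f : Flags) (s : Stacks) (l r : List Cell) :
    Reaches xp (l.length + 1)
      (.mark, f, { s with cur' := l, cur := r })
      (.scan, { f with cnt := 0 }, { s with
        cur' := [],
        cur :=
          (l.map fun c => { c with p := c.p || c.q && decide (f.cnt = 1) }).reverse ++ r }) := by
  induction l generalizing r with
  | nil => exact .single rfl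
  | cons x l ih =>
    have h := ih ({ x with p := x.p || x.q && decide (f.cnt = 1) } :: r)
    rw [List.map_cons, List.reverse_cons, List.append_assoc]
    exact .head rfl h

theorem reaches_scanRows (f : Flags) (hf : f.cnt = 0) (s : Stacks) (vs : List ι)
    (rows : List (ι → Bool)) (c : ι → Cell) (q : List (Option Bool)) :
    ∃ c' : ι → Cell,
      (∀ v, (c' v).w = (c v).w ∧ (c' v).t = (c v).t ∧ ((c' v).p = true ↔ (c v).p = true ∨
        ∃ e ∈ rows, e v = true ∧ (c v).t = true ∧ vs.countP (fun v => e v && (c v).t) = 1)) ∧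
      Reaches xp (rows.length * (2 * vs.length + 2) + 1)
        (.scan, f, { s with inp := rowCode vs rows, seen := q, cur := vs.map c, cur' := [] })
        (.scanRewind, { f with
            dead := f.dead || rows.any fun e => vs.countP (fun v => e v && (c v).t) = 0 },
          { s with
            inp := [], seen := (rowCode vs rows).reverse ++ q, cur := vs.map c', cur' := [] }) := by
  induction rows generalizing f q c with
  | nil =>
    refine ⟨c, by simp, .mono ?_ (Nat.le_add_left 1 _)⟩
    rw [List.any_nil, Bool.or_false]
    exact .single rfl
  | cons e rows ih =>
    obtain ⟨cnt, dead, acc, flag⟩ := f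
    obtain rfl : cnt = 0 := hf
    set k := vs.countP fun v => e v && (c v).t with hk
    have h₁ := reaches_scan (xp := xp) ⟨0, dead, acc, flag⟩ s vs e c (rowCode vs rows) q []
    have h₂ := reaches_mark (xp := xp) ⟨bump^[k] 0, dead || decide (bump^[k] 0 = 0), acc, flag⟩
      { s with inp := rowCode vs rows, seen := none :: ((vs.map fun v => some (e v)).reverse ++ q) }
      (vs.map fun v => { c v with q := e v && (c v).t }).reverse []
    obtain ⟨c', hc', h₃⟩ := ih ⟨0, dead || decide (k = 0), acc, flag⟩ rfl
      (fun v => { c v with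
        q := e v && (c v).t, p := (c v).p || (e v && (c v).t) && decide (k = 1) })
      (none :: ((vs.map fun v => some (e v)).reverse ++ q))
    simp only [iterate_bump_eq_zero, iterate_bump_eq_one, List.map_reverse, List.reverse_reverse,
      List.map_map, Function.comp_def, List.append_nil, ← hk] at h₁ h₂
    refine ⟨c', fun v => ⟨(hc' v).1, (hc' v).2.1, ?_⟩, ?_⟩
    · rw [(hc' v).2.2]
      simp only [Bool.or_eq_true, Bool.and_eq_true, decide_eq_true_eq, List.mem_cons,
        exists_eq_or_imp, or_assoc, and_assoc]
      rfl
    · have h := (h₁.trans h₂).trans h₃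
      simp only [Bool.or_assoc, List.length_reverse, List.length_map] at h
      rw [rowCode_cons]
      simp only [List.reverse_append, List.reverse_cons, List.append_assoc, List.singleton_append,
        List.any_cons]
      refine h.mono ?_
      rw [List.length_cons, Nat.succ_mul rows.length]
      omega

theorem reaches_shrink_of_flag (f : Flags) (s : Stacks) (vs : List ι) (c : ι → Cell)
    (l : List Cell) :
    Reaches xp (vs.length + 1)
      (.shrink, { f with flag := true }, { s with cur := vs.map c, cur' := l })
      (.shrinkBack, { f with flag := true },
        { s with cur := [], cur' := (vs.map fun v => { c v with p := false }).reverse ++ l }) := by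
  induction vs generalizing l with
  | nil => exact .single rfl
  | cons v vs ih =>
    have h := ih ({ c v with p := false } :: l)
    rw [List.map_cons, List.map_cons, List.reverse_cons, List.append_assoc]
    refine .head ?_ h
    simp only [exec, prog, popCur, go, Stacks.get, Stacks.set, List.head?, List.tail, setFlags,
      Reg.theCell, Reg.removable, Option.isSome, cond, Option.getD, Flags.toReg, Bool.not_true,
      Bool.and_false, Bool.not_false, Bool.and_true, Bool.true_or]

theorem map_update_of_notMem [DecidableEq ι] {κ : Type*} {v : ι} {vs : List ι} (hv : v ∉ vs)
    (g : ι → κ) (x : κ) : vs.map (Function.update g v x) = vs.map g :=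
  List.map_congr_left fun _ hu => Function.update_of_ne (ne_of_mem_of_not_mem hu hv) _ _

/-- One round removes at most one vertex from `T`. -/
theorem reaches_shrink (f : Flags) (s : Stacks) (vs : List ι) (hvs : vs.Nodup) (c : ι → Cell)
    (l : List Cell) :
    ∃ (c' : ι → Cell) (b : Bool),
      (∀ v ∈ vs, (c' v).w = (c v).w ∧ (c' v).p = false) ∧
      (b = false → ∀ v ∈ vs, (c' v).t = (c v).t ∧ ((c v).t = true → (c v).p = true)) ∧
      (b = true → ∃ v₀ ∈ vs, (c v₀).t = true ∧ (c v₀).p = false ∧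
        ∀ v ∈ vs, ((c' v).t = true ↔ (c v).t = true ∧ v ≠ v₀)) ∧
      Reaches xp (vs.length + 1)
        (.shrink, { f with flag := false }, { s with cur := vs.map c, cur' := l })
        (.shrinkBack, { f with flag := b },
          { s with cur := [], cur' := (vs.map c').reverse ++ l }) := by
  classical
  induction vs generalizing l with
  | nil => exact ⟨c, false, by simp, by simp, by simp, .single rfl⟩
  | cons v vs ih =>
    obtain ⟨hv, hvs⟩ := List.nodup_cons.1 hvs
    have hne : ∀ u ∈ vs, u ≠ v := fun u hu => ne_of_mem_of_not_mem hu hv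
    by_cases hr : (c v).t = true ∧ (c v).p = false
    · refine ⟨Function.update (fun u => { c u with p := false }) v
          { c v with t := false, p := false }, true, fun u _ => ?_, by simp,
        fun _ => ⟨v, List.mem_cons_self, hr.1, hr.2, fun u _ => ?_⟩, ?_⟩
      · rcases eq_or_ne u v with rfl | h <;> simp [*]
      · rcases eq_or_ne u v with rfl | h <;> simp [*]
      · have h := reaches_shrink_of_flag (xp := xp) f s vs c
          ({ c v with t := false, p := false } :: l)
        rw [List.map_cons, List.map_cons, List.reverse_cons, List.append_assoc,
          Function.update_self, map_update_of_notMem hv]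
        refine .head ?_ h
        simp only [exec, prog, popCur, go, Stacks.get, Stacks.set, List.head?, List.tail, setFlags,
          Reg.theCell, Reg.removable, Option.isSome, cond, Option.getD, Flags.toReg, hr.1, hr.2]
        rfl
    · obtain ⟨c', b, h₁, h₂, h₃, h₄⟩ := ih hvs ({ c v with p := false } :: l)
      have hr' : ((c v).t && !(c v).p) = false := by
        cases h : (c v).t <;> cases h' : (c v).p <;> simp_all
      refine ⟨Function.update c' v { c v with p := false }, b, fun u hu => ?_,
        fun hb u hu => ?_, fun hb => ?_, ?_⟩
      · rcases List.mem_cons.1 hu with rfl | hu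
        · simp
        · rw [Function.update_of_ne (hne u hu)]
          exact h₁ u hu
      · rcases List.mem_cons.1 hu with rfl | hu
        · cases h : (c u).t <;> cases h' : (c u).p <;> simp_all
        · rw [Function.update_of_ne (hne u hu)]
          exact h₂ hb u hu
      · obtain ⟨v₀, hv₀, ht, hp, h⟩ := h₃ hb
        refine ⟨v₀, List.mem_cons_of_mem _ hv₀, ht, hp, fun u hu => ?_⟩
        rcases List.mem_cons.1 hu with rfl | hu
        · have : u ≠ v₀ := fun h => hv (h ▸ hv₀)
          simp [this]
        · rw [Function.update_of_ne (hne u hu)]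
          exact h u hu
      · rw [List.map_cons, List.map_cons, List.reverse_cons, List.append_assoc,
          Function.update_self, map_update_of_notMem hv]
        refine .head ?_ h₄
        simp only [exec, prog, popCur, go, Stacks.get, Stacks.set, List.head?, List.tail, setFlags,
          Reg.theCell, Reg.removable, Option.isSome, cond, Option.getD, Flags.toReg, hr',
          Bool.not_false, Bool.and_true, Bool.false_or]

theorem reaches_shrinkBack (f : Flags) (s : Stacks) (l r : List Cell) :
    Reaches xp (l.length + 1) (.shrinkBack, f, { s with cur' := l, cur := r })
      (if f.flag then .scan else .count, { f with flag := false },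
        { s with cur' := [], cur := l.reverse ++ r }) := by
  induction l generalizing r with
  | nil =>
    obtain ⟨cnt, dead, acc, flag⟩ := f
    cases flag <;> exact .single rfl
  | cons x l ih =>
    have h := ih (x :: r)
    rw [List.reverse_cons, List.append_assoc]
    exact .head rfl h

/-- The rows of the incidence matrix of a list of hyperedges. -/
def edgeCode (rows : List (Finset (Fin n))) : List (Option Bool) :=
  rowCode (List.finRange n) (rows.map fun e v => decide (v ∈ e))

theorem length_rowCode (vs : List ι) (rows : List (ι → Bool)) :
    (rowCode vs rows).length = rows.length * (vs.length + 1) := by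
  simp [rowCode, List.length_flatMap, Nat.mul_add]

theorem length_edgeCode (rows : List (Finset (Fin n))) :
    (edgeCode rows).length = rows.length * (n + 1) := by
  rw [edgeCode, length_rowCode, List.length_map, List.length_finRange]

theorem countP_finRange (s : Finset (Fin n)) (p : Fin n → Bool)
    (h : ∀ v, p v = true ↔ v ∈ s) : (List.finRange n).countP p = s.card := by
  classical
  rw [List.countP_eq_length_filter,
    ← List.toFinset_card_of_nodup ((List.nodup_finRange n).filter _)]
  congr 1
  ext v
  simp [h]

/-- The cells `c` carry the set `W` of allowed vertices and the set `T`. -/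
def Carries (c : Fin n → Cell) (W T : Finset (Fin n)) : Prop :=
  ∀ v, ((c v).w = true ↔ v ∈ W) ∧ ((c v).t = true ↔ v ∈ T)

/-- Time for one round of the shrinking process, with `m` hyperedges. -/
def roundTime (m n : ℕ) : ℕ := m * (3 * n + 3) + 2 * n + 4

theorem countP_inter (e T : Finset (Fin n)) (c : Fin n → Cell)
    (hc : ∀ v, (c v).t = true ↔ v ∈ T) :
    (List.finRange n).countP (fun v => decide (v ∈ e) && (c v).t) = (e ∩ T).card :=
  countP_finRange _ _ fun v => by simp [hc v]

/-- A round marks the vertices with a private hyperedge, and finds out whether `T` is a hitting set.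
-/
theorem reaches_round (s : Stacks) (rows : List (Finset (Fin n))) (W T : Finset (Fin n))
    (c : Fin n → Cell) (hc : Carries c W T) (hp : ∀ v, (c v).p = false) :
    ∃ c' : Fin n → Cell, Carries c' W T ∧
      (∀ v, (c' v).p = true ↔ ∃ e ∈ rows, v ∈ e ∧ v ∈ T ∧ (e ∩ T).card = 1) ∧
      Reaches xp (rows.length * (3 * n + 3) + 2)
        (.scan, {}, { s with
          inp := edgeCode rows, seen := [], cur := (List.finRange n).map c, cur' := [] })
        (if ∃ e ∈ rows, e ∩ T = ∅ then .discard else .shrink, {}, { s with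
          inp := edgeCode rows, seen := [], cur := (List.finRange n).map c', cur' := [] }) := by
  obtain ⟨c', hc', h₁⟩ := reaches_scanRows (xp := xp) {} rfl s (List.finRange n)
    (rows.map fun e v => decide (v ∈ e)) c []
  have h₂ := reaches_scanRewind (xp := xp)
    { dead := (rows.map fun e v => decide (v ∈ e)).any fun e =>
        (List.finRange n).countP (fun v => e v && (c v).t) = 0 }
    { s with cur := (List.finRange n).map c', cur' := [] } (edgeCode rows).reverse []
  have hcount := fun e => countP_inter e T c fun v => (hc v).2
  refine ⟨c', fun v => ?_, fun v => ?_, ?_⟩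
  · rw [(hc' v).1, (hc' v).2.1]
    exact hc v
  · rw [(hc' v).2.2, hp v]
    simp [hcount, (hc v).2]
  · rw [List.reverse_reverse, List.append_nil] at h₂
    rw [List.append_nil] at h₁
    have h := h₁.trans h₂
    have hd : ((rows.map fun e v => decide (v ∈ e)).any fun e =>
        (List.finRange n).countP (fun v => e v && (c v).t) = 0) = true ↔
        ∃ e ∈ rows, e ∩ T = ∅ := by
      simp only [List.any_map, List.any_eq_true, Function.comp_apply, hcount, decide_eq_true_eq,
        Finset.card_eq_zero]
    simp only [hd] at h
    refine h.mono ?_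
    simp only [List.length_map, List.length_finRange, List.length_reverse, length_edgeCode]
    apply le_of_eq
    ring

/-- If `T` is a hitting set, then every round removes a vertex without private hyperedge, until all
vertices have one. -/
theorem reaches_minimal (s : Stacks) (rows : List (Finset (Fin n))) (W T : Finset (Fin n))
    (c : Fin n → Cell) (hc : Carries c W T) (hp : ∀ v, (c v).p = false)
    (hT : ∀ e ∈ rows, e ∩ T ≠ ∅) :
    ∃ (T' : Finset (Fin n)) (c' : Fin n → Cell),
      T' ⊆ T ∧ (∀ e ∈ rows, e ∩ T' ≠ ∅) ∧ (∀ v ∈ T', ∃ e ∈ rows, e ∩ T' = {v}) ∧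
      Carries c' W T' ∧
      Reaches xp ((T.card + 1) * roundTime rows.length n)
        (.scan, {}, { s with
          inp := edgeCode rows, seen := [], cur := (List.finRange n).map c, cur' := [] })
        (.count, {}, { s with
          inp := edgeCode rows, seen := [], cur := (List.finRange n).map c', cur' := [] }) := by
  induction hk : T.card using Nat.strong_induction_on generalizing T c with
  | _ k ih =>
  obtain ⟨c₁, hc₁, hp₁, h₁⟩ := reaches_round (xp := xp) s rows W T c hc hp
  rw [if_neg (by simpa using hT)] at h₁
  obtain ⟨c₂, b, hw, hf, ht, h₂⟩ := reaches_shrink (xp := xp) {} { s with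
    inp := edgeCode rows, seen := [] } (List.finRange n) (List.nodup_finRange n) c₁ []
  have h₃ := reaches_shrinkBack (xp := xp) { flag := b } { s with
    inp := edgeCode rows, seen := [] } (((List.finRange n).map c₂).reverse ++ []) []
  simp only [List.append_nil, List.reverse_reverse] at h₂ h₃
  have h := (h₁.trans h₂).trans h₃
  simp only [List.length_reverse, List.length_map, List.length_finRange] at h
  simp only [List.mem_finRange, true_and, forall_const] at hw hf ht
  have hround : rows.length * (3 * n + 3) + 2 + (n + 1) + (n + 1) = roundTime rows.length n := by
    rw [roundTime]
    omega
  rw [hround] at h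
  cases b with
  | false =>
    refine ⟨T, c₂, subset_rfl, hT, fun v hv => ?_, fun v => ?_, h.mono ?_⟩
    · obtain ⟨e, he, hve, -, h1⟩ := (hp₁ v).1 ((hf rfl v).2 ((hc₁ v).2.2 hv))
      obtain ⟨u, hu⟩ := Finset.card_eq_one.1 h1
      have : v ∈ e ∩ T := Finset.mem_inter.2 ⟨hve, hv⟩
      rw [hu, Finset.mem_singleton] at this
      exact ⟨e, he, this ▸ hu⟩
    · rw [(hw v).1, (hf rfl v).1]
      exact hc₁ v
    · exact Nat.le_mul_of_pos_left _ (Nat.succ_pos _)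
  | true =>
    obtain ⟨v₀, hv₀, hpv, hv⟩ := ht rfl
    have hv₀T : v₀ ∈ T := (hc₁ v₀).2.1 hv₀
    have hc₂ : Carries c₂ W (T.erase v₀) := fun v => by
      rw [(hw v).1, hv v, (hc₁ v).2, Finset.mem_erase]
      exact ⟨(hc₁ v).1, and_comm⟩
    have hT₂ : ∀ e ∈ rows, e ∩ T.erase v₀ ≠ ∅ := fun e he h0 => by
      rw [Finset.inter_erase, Finset.erase_eq_empty_iff] at h0
      rcases h0 with h0 | h0
      · exact hT e he h0
      · have hmem : v₀ ∈ e ∩ T := h0 ▸ Finset.mem_singleton_self v₀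
        have := (hp₁ v₀).2 ⟨e, he, (Finset.mem_inter.1 hmem).1, hv₀T, by rw [h0]; rfl⟩
        rw [hpv] at this
        exact Bool.false_ne_true this
    have hcard := Finset.card_erase_add_one hv₀T
    obtain ⟨T', c', hT', hhit, hpriv, hc', h'⟩ :=
      ih _ (by omega) (T.erase v₀) c₂ hc₂ (fun v => (hw v).2) hT₂ rfl
    refine ⟨T', c', hT'.trans (Finset.erase_subset _ _), hhit, hpriv, hc', (h.trans h').mono ?_⟩
    rw [← hk, ← hcard]
    apply le_of_eq
    ring

/-! ### Comparing the size of `T` with `β` -/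

theorem reaches_count (s : Stacks) (vs : List (Fin n)) (c : Fin n → Cell) (l : List Cell)
    (b b' : ℕ) :
    Reaches xp (vs.length + 1)
      (.count, {}, { s with cur := vs.map c, cur' := l, bet := U b, bet' := U b' })
      (if b ≤ vs.countP (fun v => (c v).t) then .clean else .countBack,
        { acc := b ≤ vs.countP fun v => (c v).t },
        { s with
          cur := [], cur' := (vs.map fun v => { c v with q := false }).reverse ++ l,
          bet := U (b - vs.countP fun v => (c v).t),
          bet' := U (b' + min b (vs.countP fun v => (c v).t)) }) := by
  induction vs generalizing l b b' with
  | nil => cases b <;> exact .single rfl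
  | cons v vs ih =>
    rw [List.map_cons, List.map_cons, List.reverse_cons, List.append_assoc]
    cases hv : (c v).t with
    | false =>
      rw [List.countP_cons_of_neg (p := fun v => (c v).t) (by simp [hv])]
      refine .head ?_ (ih ({ c v with q := false } :: l) b b')
      simp only [exec, prog, popCur, go, Stacks.get, Stacks.set, List.head?, List.tail,
        Reg.theCell, Option.isSome, cond, Option.getD, Flags.toReg, hv]
    | true =>
      rw [List.countP_cons_of_pos (p := fun v => (c v).t) hv]
      cases b with
      | zero =>
        have h := ih ({ c v with q := false } :: l) 0 b'
        simp only [Nat.zero_le, Nat.zero_sub, Nat.zero_min] at h ⊢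
        refine .head ?_ h
        simp only [exec, prog, popCur, go, Stacks.get, Stacks.set, List.head?, List.tail,
          Reg.theCell, Option.isSome, cond, Option.getD, Flags.toReg, hv, ifOne]
        rfl
      | succ b =>
        have h := ih ({ c v with q := false } :: l) b (b' + 1)
        simp only [Nat.add_le_add_iff_right, Nat.add_sub_add_right, Nat.add_min_add_right,
          ← Nat.add_assoc, Nat.add_right_comm b' _ 1] at h ⊢
        refine .head ?_ h
        simp only [exec, prog, popCur, go, Stacks.get, Stacks.set, List.head?, List.tail,
          Reg.theCell, Option.isSome, cond, Option.getD, Flags.toReg, hv, ifOne]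
        rfl

/-! ### Writing the children of a node -/

theorem reaches_childBack (f : Flags) (s : Stacks) (l r : List Cell) :
    Reaches xp (l.length + 1) (.childBack, f, { s with cur' := l, cur := r })
      (if f.flag then .child else if xp then .maskRow else .discard, { f with flag := false },
        { s with
          cur' := [], cur := l.reverse ++ r,
          agenda := if f.flag then .fin :: s.agenda else s.agenda }) := by
  induction l generalizing r with
  | nil =>
    obtain ⟨cnt, dead, acc, flag⟩ := f
    cases flag <;> cases xp <;> exact .single rfl
  | cons x l ih =>
    have h := ih (x :: r)
    rw [List.reverse_cons, List.append_assoc]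
    exact .head rfl h

theorem reaches_child_of_flag (s : Stacks) (vs : List ι)
    (c : ι → Cell) (l : List Cell) (g : List Item) :
    Reaches xp (vs.length + 1)
      (.child, { flag := true }, { s with cur := vs.map c, cur' := l, agenda := g })
      (.childBack, { flag := true }, { s with
        cur := [], cur' := (vs.map c).reverse ++ l,
        agenda := .beg ::
          ((vs.map fun v => .vert (childBit xp (c v).w (c v).t false)).reverse ++ g) }) := by
  induction vs generalizing l g with
  | nil => exact .single rfl
  | cons v vs ih =>
    have h := ih (c v :: l) (.vert (childBit xp (c v).w (c v).t false) :: g)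
    rw [List.map_cons, List.map_cons, List.reverse_cons, List.reverse_cons, List.append_assoc,
      List.append_assoc]
    refine .head ?_ h
    simp only [exec, prog, popCur, go, Stacks.get, Stacks.set, List.head?, List.tail, setFlags,
      Reg.theCell, Reg.selected, Option.isSome, cond, Option.getD, Flags.toReg, Bool.not_true,
      Bool.and_false, Bool.or_false]

/-- One pass writes the child that belongs to the next vertex to be branched on, and marks this
vertex. If there is none left, the pass writes a child to which no vertex belongs. -/
theorem reaches_child (s : Stacks) (vs : List ι) (hvs : vs.Nodup)
    (c : ι → Cell) (l : List Cell) (g : List Item) :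
    ∃ (c' : ι → Cell) (b : Bool) (sel : ι → Bool),
      (∀ v ∈ vs, (c' v).w = (c v).w ∧ (c' v).t = (c v).t) ∧
      (b = false → ∀ v ∈ vs, (c v).t = true → (c v).q = true) ∧
      (b = true → ∃ v₀ ∈ vs, (c v₀).t = true ∧ (c v₀).q = false ∧
        ∀ v ∈ vs, ((c' v).q = true ↔ (c v).q = true ∨ v = v₀) ∧ (sel v = true ↔ v = v₀)) ∧
      Reaches xp (vs.length + 1)
        (.child, {}, { s with cur := vs.map c, cur' := l, agenda := g })
        (.childBack, { flag := b }, { s with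
          cur := [], cur' := (vs.map c').reverse ++ l,
          agenda := .beg ::
            ((vs.map fun v => .vert (childBit xp (c v).w (c v).t (sel v))).reverse ++ g) }) := by
  classical
  induction vs generalizing l g with
  | nil => exact ⟨c, false, fun _ => false, by simp, by simp, by simp, .single rfl⟩
  | cons v vs ih =>
    obtain ⟨hv, hvs⟩ := List.nodup_cons.1 hvs
    have hne : ∀ u ∈ vs, u ≠ v := fun u hu => ne_of_mem_of_not_mem hu hv
    by_cases hr : (c v).t = true ∧ (c v).q = false
    · refine ⟨Function.update c v { c v with q := true }, true,
        Function.update (fun _ => false) v true, fun u _ => ?_, by simp, fun _ =>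
        ⟨v, List.mem_cons_self, hr.1, hr.2, fun u _ => ?_⟩, ?_⟩
      · rcases eq_or_ne u v with rfl | h <;> simp [*]
      · rcases eq_or_ne u v with rfl | h <;> simp [*]
      · have h := reaches_child_of_flag (xp := xp) s vs c ({ c v with q := true } :: l)
          (.vert (childBit xp (c v).w (c v).t true) :: g)
        rw [List.map_cons, List.map_cons, List.map_cons, List.reverse_cons, List.reverse_cons,
          List.append_assoc, List.append_assoc, Function.update_self, Function.update_self,
          map_update_of_notMem hv,
          List.map_congr_left (f := fun u => Item.vert (childBit xp (c u).w (c u).t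
            (Function.update (fun _ => false) v true u)))
            (g := fun u => Item.vert (childBit xp (c u).w (c u).t false))
            (fun u hu => by rw [Function.update_of_ne (hne u hu)])]
        refine .head ?_ h
        simp only [exec, prog, popCur, go, Stacks.get, Stacks.set, List.head?, List.tail, setFlags,
          Reg.theCell, Reg.selected, Option.isSome, cond, Option.getD, Flags.toReg, hr.1, hr.2]
        rfl
    · have hr' : ((c v).t && !(c v).q) = false := by
        cases h : (c v).t <;> cases h' : (c v).q <;> simp_all
      obtain ⟨c', b, sel, h₁, h₂, h₃, h₄⟩ :=
        ih hvs (c v :: l) (.vert (childBit xp (c v).w (c v).t false) :: g)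
      refine ⟨Function.update c' v (c v), b, Function.update sel v false, fun u hu => ?_,
        fun hb u hu => ?_, fun hb => ?_, ?_⟩
      · rcases List.mem_cons.1 hu with rfl | hu
        · simp
        · rw [Function.update_of_ne (hne u hu)]
          exact h₁ u hu
      · rcases List.mem_cons.1 hu with rfl | hu
        · cases h : (c u).t <;> cases h' : (c u).q <;> simp_all
        · exact h₂ hb u hu
      · obtain ⟨v₀, hv₀, ht, hp, h⟩ := h₃ hb
        refine ⟨v₀, List.mem_cons_of_mem _ hv₀, ht, hp, fun u hu => ?_⟩
        rcases List.mem_cons.1 hu with rfl | hu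
        · simp [(hne v₀ hv₀).symm]
        · rw [Function.update_of_ne (hne u hu), Function.update_of_ne (hne u hu)]
          exact h u hu
      · rw [List.map_cons, List.map_cons, List.map_cons, List.reverse_cons, List.reverse_cons,
          List.append_assoc, List.append_assoc, Function.update_self, Function.update_self,
          map_update_of_notMem hv,
          List.map_congr_left (f := fun u => Item.vert (childBit xp (c u).w (c u).t
            (Function.update sel v false u)))
            (g := fun u => Item.vert (childBit xp (c u).w (c u).t (sel u)))
            (fun u hu => by rw [Function.update_of_ne (hne u hu)])]
        refine .head ?_ h₄
        simp only [exec, prog, popCur, go, Stacks.get, Stacks.set, List.head?, List.tail, setFlags,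
          Reg.theCell, Reg.selected, Option.isSome, cond, Option.getD, Flags.toReg, hr',
          Bool.not_false, Bool.and_true, Bool.or_false]

/-- A node on the agenda. -/
def entry (W : Finset (Fin n)) : List Item :=
  .beg :: (((List.finRange n).map fun v => .vert (decide (v ∈ W))).reverse ++ [.fin])

/-- The child of the node `W` that belongs to the vertex `v` of `M`. For `xp = false`, the set `M`
is the minimal hitting set of the node; for `xp = true`, it is a hyperedge. -/
def childSet (xp : Bool) (W M : Finset (Fin n)) (v : Fin n) : Finset (Fin n) :=
  if xp then W \ M.erase v else W.erase v

theorem decide_mem_childSet {c : Fin n → Cell} {W M : Finset (Fin n)} (hc : Carries c W M)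
    {u v : Fin n} {sel : Bool} (hsel : sel = true ↔ u = v) :
    decide (u ∈ childSet xp W M v) = childBit xp (c u).w (c u).t sel := by
  rw [Bool.eq_iff_iff, decide_eq_true_eq]
  cases xp
  · simp [childSet, childBit, (hc u).1, ← hsel, and_comm]
  · simp [childSet, childBit, (hc u).1, ← (hc u).2, ← hsel]
    cases sel <;> cases (c u).t <;> simp

/-- The loop that writes one child for each element of `R` and possibly one more. -/
theorem reaches_children (s : Stacks) (W M R : Finset (Fin n)) (c : Fin n → Cell)
    (hc : Carries c W M) (hR : ∀ v, v ∈ R ↔ v ∈ M ∧ (c v).q = false) (g : List Item) :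
    ∃ (ws : List (Finset (Fin n))) (c' : Fin n → Cell), Carries c' W M ∧
      ws.length ≤ R.card + 1 ∧ (∀ v ∈ R, childSet xp W M v ∈ ws) ∧
      Reaches xp ((R.card + 1) * (2 * n + 2) + n + 1)
        (.childBack, { flag := true }, { s with
          cur := [], cur' := ((List.finRange n).map c).reverse, agenda := g })
        (if xp then .maskRow else .discard, {}, { s with
          cur := (List.finRange n).map c', cur' := [], agenda := ws.flatMap entry ++ g }) := by
  induction hk : R.card using Nat.strong_induction_on generalizing R c g with
  | _ k ih =>
  obtain ⟨c', b, sel, hwt, hf, ht, h₂⟩ := reaches_child (xp := xp) s (List.finRange n)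
    (List.nodup_finRange n) c [] (.fin :: g)
  have h₁ := reaches_childBack (xp := xp) { flag := true } { s with agenda := g }
    ((List.finRange n).map c).reverse []
  simp only [List.append_nil, List.reverse_reverse, List.length_reverse, List.length_map,
    List.length_finRange, if_true] at h₁ h₂
  simp only [List.mem_finRange, true_and, forall_const] at hwt hf ht
  have hc' : Carries c' W M := fun v => by
    rw [(hwt v).1, (hwt v).2]
    exact hc v
  let X : Finset (Fin n) := Finset.univ.filter fun u => childBit xp (c u).w (c u).t (sel u) = true
  have hX : ∀ u, childBit xp (c u).w (c u).t (sel u) = decide (u ∈ X) := fun u => by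
    simp [X]
  have hentry : Item.beg :: (((List.finRange n).map fun u =>
      Item.vert (childBit xp (c u).w (c u).t (sel u))).reverse ++ Item.fin :: g) =
        entry X ++ g := by
    simp only [hX, entry, List.cons_append, List.append_assoc, List.nil_append]
  rw [hentry] at h₂
  cases b with
  | false =>
    have h₃ := reaches_childBack (xp := xp) {} { s with agenda := entry X ++ g }
      ((List.finRange n).map c').reverse []
    simp only [List.append_nil, List.reverse_reverse, List.length_reverse, List.length_map,
      List.length_finRange, if_false, Bool.false_eq_true] at h₃
    have hR0 : R = ∅ := Finset.eq_empty_of_forall_notMem fun v hv => by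
      have := hf rfl v ((hc v).2.2 ((hR v).1 hv).1)
      rw [((hR v).1 hv).2] at this
      exact Bool.false_ne_true this
    refine ⟨[X], c', hc', by simp, by simp [hR0], ?_⟩
    rw [List.flatMap_singleton]
    refine ((h₁.trans h₂).trans h₃).mono ?_
    rw [Nat.succ_mul k]
    omega
  | true =>
    obtain ⟨v₀, hv₀, hqv, hv⟩ := ht rfl
    have hv₀R : v₀ ∈ R := (hR v₀).2 ⟨(hc v₀).2.1 hv₀, hqv⟩
    have hcard := Finset.card_erase_add_one hv₀R
    have hX₀ : X = childSet xp W M v₀ := by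
      ext u
      rw [← decide_eq_decide, ← hX, decide_mem_childSet hc (hv u).2]
    obtain ⟨ws, c'', hc'', hlen, hmem, h⟩ := ih _ (by omega) (R.erase v₀) c' hc' (fun v => by
      rw [Finset.mem_erase, hR, ← Bool.not_eq_true (c' v).q, (hv v).1, ← Bool.not_eq_true]
      tauto) (entry X ++ g) rfl
    refine ⟨ws ++ [X], c'', hc'', ?_, fun v hvR => ?_, ?_⟩
    · rw [List.length_append, List.length_singleton]
      omega
    · by_cases h : v = v₀
      · rw [h, ← hX₀]
        exact List.mem_append_right _ (List.mem_singleton_self _)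
      · exact List.mem_append_left _ (hmem v (Finset.mem_erase.2 ⟨h, hvR⟩))
    · rw [List.flatMap_append, List.flatMap_singleton, List.append_assoc]
      refine ((h₁.trans h₂).trans h).mono ?_
      rw [← hk, ← hcard, Nat.succ_mul ((R.erase v₀).card + 1)]
      omega

theorem reaches_maskRow (s : Stacks) (vs : List ι) (e : ι → Bool) (c : ι → Cell)
    (r q : List (Option Bool)) (l : List Cell) :
    Reaches xp (vs.length + 1)
      (.maskRow, {}, { s with
        inp := vs.map (fun v => some (e v)) ++ none :: r, seen := q, cur := vs.map c, cur' := l })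
      (.childBack, { flag := true }, { s with
        inp := r, seen := none :: ((vs.map fun v => some (e v)).reverse ++ q), cur := [],
        cur' := (vs.map fun v => { c v with t := e v, q := false }).reverse ++ l }) := by
  induction vs generalizing q l with
  | nil => exact .single rfl
  | cons v vs ih =>
    have h := ih (some (e v) :: q) ({ c v with t := e v, q := false } :: l)
    simp only [List.map_cons, List.reverse_cons, List.append_assoc, List.cons_append]
    exact .head rfl h

theorem edgeCode_cons (e : Finset (Fin n)) (rows : List (Finset (Fin n))) :
    edgeCode (e :: rows) =
      (List.finRange n).map (fun v => some (decide (v ∈ e))) ++ none :: edgeCode rows :=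
  rowCode_cons _ _ _

theorem reaches_maskRows (s : Stacks) (rows : List (Finset (Fin n))) (W M : Finset (Fin n))
    (c : Fin n → Cell) (hc : Carries c W M) (q : List (Option Bool)) (g : List Item) :
    ∃ (ws : List (Finset (Fin n))) (c' : Fin n → Cell),
      ws.length ≤ rows.length * (n + 1) ∧ (∀ e ∈ rows, ∀ v ∈ e, childSet true W e v ∈ ws) ∧
      Reaches true (rows.length * ((n + 1) * (2 * n + 4)) + 1)
        (.maskRow, {}, { s with
          inp := edgeCode rows, seen := q, cur := (List.finRange n).map c, cur' := [],
          agenda := g })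
        (.maskRewind, {}, { s with
          inp := [], seen := (edgeCode rows).reverse ++ q, cur := (List.finRange n).map c',
          cur' := [], agenda := ws.flatMap entry ++ g }) := by
  induction rows generalizing M c q g with
  | nil => exact ⟨[], c, by simp, by simp, .mono (.single rfl) (Nat.le_add_left 1 _)⟩
  | cons e rows ih =>
    have h₁ := reaches_maskRow (xp := true) { s with agenda := g } (List.finRange n)
      (fun v => decide (v ∈ e)) c (edgeCode rows) q []
    have hce : Carries (fun v => { c v with t := decide (v ∈ e), q := false }) W e :=
      fun v => ⟨(hc v).1, decide_eq_true_iff⟩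
    obtain ⟨ws, c', hc', hlen, hmem, h₂⟩ := reaches_children (xp := true) { s with
        inp := edgeCode rows,
        seen := none :: (((List.finRange n).map fun v => some (decide (v ∈ e))).reverse ++ q) }
      W e e _ hce (fun v => by simp) g
    obtain ⟨ws', c'', hlen', hmem', h₃⟩ := ih e c' hc'
      (none :: (((List.finRange n).map fun v => some (decide (v ∈ e))).reverse ++ q))
      (ws.flatMap entry ++ g)
    have hcard : e.card ≤ n := (Finset.card_le_univ e).trans_eq (Fintype.card_fin n)
    refine ⟨ws' ++ ws, c'', ?_, fun e' he' v hv => ?_, ?_⟩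
    · rw [List.length_append, List.length_cons, Nat.succ_mul]
      omega
    · rcases List.mem_cons.1 he' with rfl | he'
      · exact List.mem_append_right _ (hmem v hv)
      · exact List.mem_append_left _ (hmem' e' he' v hv)
    · rw [List.append_nil] at h₁
      have h := (h₁.trans h₂).trans h₃
      rw [edgeCode_cons]
      simp only [List.reverse_append, List.reverse_cons, List.append_assoc, List.singleton_append,
        List.flatMap_append]
      refine h.mono ?_
      rw [List.length_cons, List.length_finRange, Nat.succ_mul rows.length]
      have : (e.card + 1) * (2 * n + 2) ≤ (n + 1) * (2 * n + 2) := by gcongr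
      have : (n + 1) * (2 * n + 4) = (n + 1) * (2 * n + 2) + 2 * n + 2 := by ring
      omega

theorem reaches_discard (f : Flags) (s : Stacks) (l l' : List Cell) :
    Reaches xp (l.length + l'.length + 1) (.discard, f, { s with cur := l, cur' := l' })
      (.pick, f, { s with cur := [], cur' := [] }) := by
  induction l with
  | cons x l ih =>
    rw [List.length_cons, Nat.add_right_comm l.length]
    exact .head rfl ih
  | nil =>
    induction l' with
    | nil => exact .single rfl
    | cons x l ih => exact .head rfl ih

/-- The children of a node in the search tree; `T` is the minimal hitting set of the node. -/
def IsChild (xp : Bool) (rows : List (Finset (Fin n))) (W T X : Finset (Fin n)) : Prop :=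
  if xp then ∃ e ∈ rows, ∃ v ∈ e, X = W \ e.erase v else ∃ v ∈ T, X = W.erase v

/-- A bound for the number of children that are written, where `t` is the size of the minimal
hitting set. For each set of marked vertices, the loop over these vertices ends with one superfluous
child, to which no vertex belongs; it does no harm, since no node can make the search succeed
wrongly. -/
def width (xp : Bool) (m n t : ℕ) : ℕ := if xp then m * (n + 1) else t + 1

/-- Time for writing the children of a node. -/
def expandTime (m n : ℕ) : ℕ := (m + 1) * ((n + 1) * (2 * n + 5)) + 2 * n + 5

theorem reaches_expand (s : Stacks) (rows : List (Finset (Fin n))) (W T : Finset (Fin n))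
    (c : Fin n → Cell) (hc : Carries c W T) (hq : ∀ v, (c v).q = false) (d d' : ℕ)
    (g : List Item) :
    ∃ ws : List (Finset (Fin n)), ws.length ≤ width xp rows.length n T.card ∧
      (∀ X, IsChild xp rows W T X → X ∈ ws) ∧
      Reaches xp (expandTime rows.length n)
        (.expand, {}, { s with
          inp := edgeCode rows, seen := [], cur := [], cur' := ((List.finRange n).map c).reverse,
          dep := U (d + 1), dep' := U d', agenda := g })
        (.pick, {}, { s with
          inp := edgeCode rows, seen := [], cur := [], cur' := [],
          dep := U d, dep' := U (d' + 1), agenda := ws.flatMap entry ++ .ret :: g }) := by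
  cases xp with
  | false =>
    obtain ⟨ws, c', -, hlen, hmem, h₂⟩ := reaches_children (xp := false) { s with
      inp := edgeCode rows, seen := [], dep := U d, dep' := U (d' + 1) } W T T c hc
      (fun v => by simp [hq]) (.ret :: g)
    have h₃ := reaches_discard (xp := false) {} { s with
      inp := edgeCode rows, seen := [], dep := U d, dep' := U (d' + 1),
      agenda := ws.flatMap entry ++ .ret :: g } ((List.finRange n).map c') []
    refine ⟨ws, hlen, ?_, .mono (.head rfl (h₂.trans h₃)) ?_⟩
    · rintro X ⟨v, hv, rfl⟩
      exact hmem v hv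
    · have : (T.card + 1) * (2 * n + 2) ≤ (n + 1) * (2 * n + 2) := by
        gcongr
        exact (Finset.card_le_univ T).trans_eq (Fintype.card_fin n)
      rw [expandTime, Nat.succ_mul rows.length]
      simp only [List.length_map, List.length_finRange, List.length_nil]
      nlinarith [Nat.zero_le (rows.length * ((n + 1) * (2 * n + 5)))]
  | true =>
    have h₁ := reaches_childBack (xp := true) {} { s with
      inp := edgeCode rows, seen := [], dep := U d, dep' := U (d' + 1), agenda := .ret :: g }
      ((List.finRange n).map c).reverse []
    obtain ⟨ws, c', hlen, hmem, h₂⟩ := reaches_maskRows { s with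
      dep := U d, dep' := U (d' + 1) } rows W T c hc [] (.ret :: g)
    have h₃ := reaches_maskRewind (xp := true) {} { s with
      dep := U d, dep' := U (d' + 1), cur := (List.finRange n).map c', cur' := [],
      agenda := ws.flatMap entry ++ .ret :: g } (edgeCode rows).reverse []
    have h₄ := reaches_discard (xp := true) {} { s with
      inp := edgeCode rows, seen := [], dep := U d, dep' := U (d' + 1),
      agenda := ws.flatMap entry ++ .ret :: g } ((List.finRange n).map c') []
    simp only [List.append_nil, List.reverse_reverse] at h₁ h₂ h₃
    refine ⟨ws, hlen, ?_, .mono (.head rfl (((h₁.trans h₂).trans h₃).trans h₄)) ?_⟩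
    · rintro X ⟨e, he, v, hv, rfl⟩
      exact hmem e he v hv
    · rw [expandTime, Nat.succ_mul rows.length]
      simp only [List.length_reverse, List.length_map, List.length_finRange, List.length_nil,
        length_edgeCode]
      have : rows.length * ((n + 1) * (2 * n + 5)) =
        rows.length * ((n + 1) * (2 * n + 4)) + rows.length * (n + 1) := by ring
      nlinarith

/-! ### The search -/

theorem reaches_unpack (s : Stacks) (l : List Bool) (r : List Cell) (g : List Item) :
    Reaches xp (l.length + 1)
      (.unpack, {}, { s with agenda := l.map Item.vert ++ .fin :: g, cur := r })
      (.scan, {}, { s with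
        agenda := g, cur := (l.map fun w => ⟨w, w, false, false⟩).reverse ++ r }) := by
  induction l generalizing r with
  | nil => exact .single rfl
  | cons x l ih =>
    have h := ih (⟨x, x, false, false⟩ :: r)
    rw [List.map_cons, List.map_cons, List.reverse_cons, List.append_assoc]
    cases x <;> exact .head rfl h

theorem reaches_unpack_entry (s : Stacks) (W : Finset (Fin n)) (g : List Item) :
    Reaches xp (n + 2)
      (.pick, {}, { s with agenda := entry W ++ g, cur := [] })
      (.scan, {}, { s with
        agenda := g,
        cur := (List.finRange n).map fun v =>
          ⟨decide (v ∈ W), decide (v ∈ W), false, false⟩ }) := by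
  have h := reaches_unpack (xp := xp) s ((List.finRange n).map fun v => decide (v ∈ W)).reverse [] g
  simp only [List.map_reverse, List.map_map, List.reverse_reverse, List.append_nil,
    List.length_reverse, List.length_map, List.length_finRange, Function.comp_def] at h
  rw [entry, List.cons_append, List.append_assoc]
  exact .head rfl h

/-- The stacks between the visits of two nodes: the rows are `rows`, the copy of `β` is `b`, the
remaining depth is `d`, the depth that has been used up is `d'`, and the agenda is `g`. -/
def Stacks.between (s : Stacks) (rows : List (Finset (Fin n))) (b d d' : ℕ) (g : List Item) :
    Stacks :=
  { s with
    inp := edgeCode rows, seen := [], cur := [], cur' := [], bet := U b, bet' := [],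
    dep := U d, dep' := U d', agenda := g }

/-- The total number of symbols on the stacks other than the output. -/
def Stacks.size (s : Stacks) : ℕ :=
  s.inp.length + s.seen.length + s.bin.length + s.cap.length + s.bet.length + s.bet'.length +
    s.alp.length + s.alp'.length + s.dep.length + s.dep'.length + s.cur.length + s.cur'.length +
    s.agenda.length

/-- `T` is a hitting set of the hyperedges in `rows`, and every element of `T` has a private
hyperedge. -/
def IsMinHit (rows : List (Finset (Fin n))) (T : Finset (Fin n)) : Prop :=
  (∀ e ∈ rows, e ∩ T ≠ ∅) ∧ ∀ v ∈ T, ∃ e ∈ rows, e ∩ T = {v}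

/-- Time for the visit of a node, without the visits of its descendants. -/
def nodeTime (m n b : ℕ) : ℕ := (n + 1) * roundTime m n + expandTime m n + b + 3 * n + 6

/-- The visit of a node ends in one of four ways: the search succeeds; the node is not a hitting
set; there is no depth left; or the children of the node are put on the agenda. -/
theorem reaches_node (s : Stacks) (rows : List (Finset (Fin n))) (b d d' : ℕ)
    (W : Finset (Fin n)) (g : List Item) :
    (∃ (T : Finset (Fin n)) (s' : Stacks), IsMinHit rows T ∧ b ≤ T.card ∧ s'.out = s.out ∧
      s'.size ≤ (s.between rows b d d' (entry W ++ g)).size ∧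
      Reaches xp (nodeTime rows.length n b)
        (.pick, {}, s.between rows b d d' (entry W ++ g)) (.clean, { acc := true }, s')) ∨
    ((∃ e ∈ rows, e ∩ W = ∅) ∧
      Reaches xp (nodeTime rows.length n b)
        (.pick, {}, s.between rows b d d' (entry W ++ g)) (.pick, {}, s.between rows b d d' g)) ∨
    (∃ T ⊆ W, IsMinHit rows T ∧ T.card < b ∧ d = 0 ∧
      Reaches xp (nodeTime rows.length n b)
        (.pick, {}, s.between rows b d d' (entry W ++ g)) (.pick, {}, s.between rows b d d' g)) ∨
    ∃ T ⊆ W, IsMinHit rows T ∧ T.card < b ∧ ∃ (d₀ : ℕ) (ws : List (Finset (Fin n))), d = d₀ + 1 ∧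
      ws.length ≤ width xp rows.length n T.card ∧ (∀ X, IsChild xp rows W T X → X ∈ ws) ∧
      Reaches xp (nodeTime rows.length n b)
        (.pick, {}, s.between rows b d d' (entry W ++ g))
        (.pick, {}, s.between rows b d₀ (d' + 1) (ws.flatMap entry ++ .ret :: g)) := by
  let s₀ : Stacks := { s with
    inp := edgeCode rows, seen := [], cur' := [], bet := U b, bet' := [], dep := U d, dep' := U d' }
  let c : Fin n → Cell := fun v => ⟨decide (v ∈ W), decide (v ∈ W), false, false⟩
  have hc : Carries c W W := fun v => ⟨decide_eq_true_iff, decide_eq_true_iff⟩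
  have h₁ : Reaches xp (n + 2) (.pick, {}, s.between rows b d d' (entry W ++ g))
      (.scan, {}, { s₀ with agenda := g, cur := (List.finRange n).map c }) :=
    reaches_unpack_entry s₀ W g
  by_cases hW : ∃ e ∈ rows, e ∩ W = ∅
  · refine .inr (.inl ⟨hW, ?_⟩)
    obtain ⟨c', -, -, h₂⟩ := reaches_round (xp := xp) { s₀ with agenda := g } rows W W c hc
      fun _ => rfl
    rw [if_pos hW] at h₂
    have h₃ := reaches_discard (xp := xp) {} { s₀ with agenda := g } ((List.finRange n).map c') []
    refine ((h₁.trans h₂).trans h₃).mono ?_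
    rw [nodeTime, roundTime, List.length_map, List.length_finRange, List.length_nil, Nat.succ_mul n]
    omega
  push Not at hW
  obtain ⟨T, c', hTW, hhit, hpriv, hc', h₂⟩ := reaches_minimal (xp := xp)
    { s₀ with agenda := g } rows W W c hc (fun _ => rfl)
    (fun e he => (hW e he).ne_empty)
  have hT : IsMinHit rows T := ⟨hhit, hpriv⟩
  have hcount : (List.finRange n).countP (fun v => (c' v).t) = T.card :=
    countP_finRange T _ fun v => (hc' v).2
  have h₃ := reaches_count (xp := xp) { s₀ with agenda := g } (List.finRange n) c' [] b 0
  rw [hcount] at h₃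
  have htime : (W.card + 1) * roundTime rows.length n ≤ (n + 1) * roundTime rows.length n := by
    gcongr
    exact (Finset.card_le_univ W).trans_eq (Fintype.card_fin n)
  have h₁₂₃ := (h₁.trans h₂).trans h₃
  rw [List.length_finRange, List.append_nil, Nat.zero_add] at h₁₂₃
  by_cases hb : b ≤ T.card
  · rw [if_pos hb, decide_eq_true hb] at h₁₂₃
    refine .inl ⟨T, _, hT, hb, ?_, ?_, h₁₂₃.mono ?_⟩
    · rfl
    · simp only [Stacks.size, Stacks.between, s₀, List.length_reverse, List.length_map,
        List.length_finRange, List.length_replicate, List.length_append, entry, List.length_cons,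
        List.length_nil]
      omega
    · rw [nodeTime]
      omega
  rw [if_neg hb, decide_eq_false hb, Nat.min_eq_right (by omega)] at h₁₂₃
  have h₄ := reaches_countBack (xp := xp) {} { s₀ with
    agenda := g, cur := [],
    cur' := ((List.finRange n).map fun v => { c' v with q := false }).reverse } T.card (b - T.card)
  rw [show b - T.card + T.card = b by omega] at h₄
  have h := h₁₂₃.trans h₄
  refine .inr (.inr ?_)
  cases d with
  | zero =>
    refine .inl ⟨T, hTW, hT, by omega, rfl, ?_⟩
    have h₅ := reaches_discard (xp := xp) {} { s₀ with agenda := g } []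
      ((List.finRange n).map fun v => { c' v with q := false }).reverse
    refine (h.trans (.head rfl h₅)).mono ?_
    rw [nodeTime, expandTime, List.length_reverse, List.length_map, List.length_finRange,
      List.length_nil]
    omega
  | succ d =>
    obtain ⟨ws, hlen, hmem, h₅⟩ := reaches_expand (xp := xp) s₀ rows W T
      (fun v => { c' v with q := false }) hc' (fun _ => rfl) d d' g
    refine .inr ⟨T, hTW, hT, by omega, d, ws, rfl, hlen, hmem, (h.trans h₅).mono ?_⟩
    rw [nodeTime]
    omega

/-- A bound for the cost of a search of depth `d`, if a node has at most `k` children and a cost of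
at most `Q`. -/
def searchTime (Q k d : ℕ) : ℕ := Q * (d + 1) * k ^ d

theorem add_le_searchTime_succ (Q k d : ℕ) (hk : 1 ≤ k) :
    Q + k * searchTime Q k d ≤ searchTime Q k (d + 1) := by
  have h : Q ≤ Q * k ^ (d + 1) := Nat.le_mul_of_pos_right _ (pow_pos hk _)
  calc Q + k * searchTime Q k d = Q + Q * (d + 1) * k ^ (d + 1) := by rw [searchTime]; ring
    _ ≤ Q * k ^ (d + 1) + Q * (d + 1) * k ^ (d + 1) := by omega
    _ = searchTime Q k (d + 1) := by rw [searchTime]; ring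

theorem length_entry (W : Finset (Fin n)) : (entry W).length = n + 2 := by
  simp [entry]

theorem length_flatMap_entry (ws : List (Finset (Fin n))) :
    (ws.flatMap entry).length = ws.length * (n + 2) := by
  simp [List.length_flatMap, length_entry]

/-- The outcome of the search below some nodes, whose costs are at most `t`: either a minimal
hitting set with at least `b` elements is found, or the search goes on with the agenda `g` and the
statement `P` holds. -/
def Outcome (xp : Bool) (t : ℕ) (s : Stacks) (rows : List (Finset (Fin n))) (b d d' : ℕ)
    (g₀ g : List Item) (P : Prop) : Prop :=
  (∃ (T : Finset (Fin n)) (s' : Stacks), IsMinHit rows T ∧ b ≤ T.card ∧ s'.out = s.out ∧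
    s'.size ≤ (s.between rows b d d' g₀).size + t ∧
    Reaches xp t (.pick, {}, s.between rows b d d' g₀) (.clean, { acc := true }, s')) ∨
  (P ∧ Reaches xp t (.pick, {}, s.between rows b d d' g₀) (.pick, {}, s.between rows b d d' g))

/-- Correctness and running time of the search. Here `C d W` says that the search below the node `W`
with remaining depth `d` has to succeed. -/
theorem search (rows : List (Finset (Fin n))) (b k Q : ℕ) (C : ℕ → Finset (Fin n) → Prop)
    (hk : 1 ≤ k) (hkw : ∀ t < b, width xp rows.length n t ≤ k)
    (hQ : nodeTime rows.length n b + k * (n + 2) + 1 ≤ Q)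
    (hlive : ∀ d W, C d W → ∀ e ∈ rows, e ∩ W ≠ ∅)
    (hstep : ∀ d W T, C d W → T ⊆ W → IsMinHit rows T → T.card < b →
      ∃ d₀ X, d = d₀ + 1 ∧ IsChild xp rows W T X ∧ C d₀ X)
    (d : ℕ) (W : Finset (Fin n)) (s : Stacks) (d' : ℕ) (g : List Item) :
    Outcome xp (searchTime Q k d) s rows b d d' (entry W ++ g) g (¬C d W) := by
  induction d generalizing W d' g with
  | zero =>
    have hQ' : searchTime Q k 0 = Q := by simp [searchTime]
    rw [hQ']
    rcases reaches_node (xp := xp) s rows b 0 d' W g with ⟨T, s', hT, hb, ho, hs, h⟩ |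
      ⟨⟨e, he, h0⟩, h⟩ | ⟨T, hTW, hT, hb, -, h⟩ | ⟨T, hTW, hT, hb, d₀, ws, hd, -⟩
    · exact .inl ⟨T, s', hT, hb, ho, by omega, h.mono (by omega)⟩
    · exact .inr ⟨fun hC => hlive _ _ hC e he h0, h.mono (by omega)⟩
    · refine .inr ⟨fun hC => ?_, h.mono (by omega)⟩
      obtain ⟨d₀, X, hd, -⟩ := hstep _ _ T hC hTW hT hb
      omega
    · omega
  | succ d ih =>
    have hF := add_le_searchTime_succ Q k d hk
    -- the search below a list of nodes
    have hlist : ∀ (ws : List (Finset (Fin n))) (d' : ℕ) (g : List Item),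
        Outcome xp (ws.length * searchTime Q k d) s rows b d d' (ws.flatMap entry ++ g) g
          (∀ X ∈ ws, ¬C d X) := by
      intro ws d' g
      induction ws with
      | nil => exact .inr ⟨by simp, .refl _⟩
      | cons X ws ihl =>
        rw [List.flatMap_cons, List.append_assoc, List.length_cons, Nat.succ_mul]
        rcases ih X d' (ws.flatMap entry ++ g) with ⟨T, s', hT, hb, ho, hs, h⟩ | ⟨hX, h⟩
        · exact .inl ⟨T, s', hT, hb, ho, by omega, h.mono (Nat.le_add_left _ _)⟩
        rcases ihl with ⟨T, s', hT, hb, ho, hs, h'⟩ | ⟨hws, h'⟩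
        · refine .inl ⟨T, s', hT, hb, ho, ?_, (h.trans h').mono (by omega)⟩
          simp only [Stacks.size, Stacks.between, List.length_append] at hs ⊢
          omega
        · exact .inr ⟨List.forall_mem_cons.2 ⟨hX, hws⟩, (h.trans h').mono (by omega)⟩
    rcases reaches_node (xp := xp) s rows b (d + 1) d' W g with ⟨T, s', hT, hb, ho, hs, h⟩ |
      ⟨⟨e, he, h0⟩, h⟩ | ⟨T, hTW, hT, hb, h0, h⟩ | ⟨T, hTW, hT, hb, d₀, ws, hd, hlen, hmem, h⟩
    · exact .inl ⟨T, s', hT, hb, ho, by omega, h.mono (by omega)⟩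
    · exact .inr ⟨fun hC => hlive _ _ hC e he h0, h.mono (by omega)⟩
    · omega
    · obtain rfl : d₀ = d := by omega
      have hwk : ws.length ≤ k := hlen.trans (hkw _ hb)
      have hwt : ws.length * searchTime Q k d₀ ≤ k * searchTime Q k d₀ :=
        Nat.mul_le_mul_right _ hwk
      rcases hlist ws (d' + 1) (.ret :: g) with ⟨T', s', hT', hb', ho, hs, h'⟩ | ⟨hws, h'⟩
      · refine .inl ⟨T', s', hT', hb', ho, ?_, (h.trans h').mono (by omega)⟩
        have : ws.length * (n + 2) ≤ k * (n + 2) := Nat.mul_le_mul_right _ hwk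
        simp only [Stacks.size, Stacks.between, List.length_append, List.length_cons,
          length_flatMap_entry, length_entry, List.length_replicate] at hs ⊢
        omega
      · refine .inr ⟨fun hC => ?_, ((h.trans h').trans (.single rfl)).mono (by omega)⟩
        obtain ⟨d₁, X, hd₁, hX, hCX⟩ := hstep _ _ T hC hTW hT hb
        obtain rfl : d₁ = d₀ := by omega
        exact hws X (hmem X hX) hCX

/-! ### The end of the computation -/

/-- When all stacks are empty, the machine writes its answer and halts. -/
theorem exec_clean_halt (f : Flags) :
    exec (prog xp .clean) f.toReg {} = (none, {}, { out := [f.acc] }) := rfl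

theorem isSome_head?_or {α : Type*} (l : List α) (b : Bool) :
    (b || l.head?.isSome) = (b || decide (0 < l.length)) := by
  cases l <;> simp

theorem exec_clean (f : Flags) (s : Stacks) (hs : 0 < s.size) :
    ∃ s' : Stacks, exec (prog xp .clean) f.toReg s = (some .clean, f.toReg, s') ∧
      s'.out = s.out ∧ s'.size < s.size := by
  refine ⟨⟨s.inp.tail, s.out, s.seen.tail, s.bin.tail, s.cap.tail, s.bet.tail, s.bet'.tail,
    s.alp.tail, s.alp'.tail, s.dep.tail, s.dep'.tail, s.cur.tail, s.cur'.tail, s.agenda.tail⟩,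
    ?_, rfl, ?_⟩
  · simp only [exec, prog, ifOne, go, Stacks.get, Stacks.set, isSome_head?_or, Flags.toReg,
      ← Bool.decide_or, Bool.false_or]
    rw [decide_eq_true, cond_true]
    rw [Stacks.size] at hs
    omega
  · have htail : ∀ {α : Type} (l : List α), l.tail.length ≤ l.length ∧
        (0 < l.length → l.tail.length < l.length) := fun l => by cases l <;> simp
    have hadd : ∀ {a a' b b' : ℕ}, (a ≤ b ∧ (0 < b → a < b)) → (a' ≤ b' ∧ (0 < b' → a' < b')) →
        a + a' ≤ b + b' ∧ (0 < b + b' → a + a' < b + b') := by omega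
    have hlt : ∀ {a b : ℕ}, (a ≤ b ∧ (0 < b → a < b)) → 0 < b → a < b := And.right
    refine hlt ?_ hs
    rw [Stacks.size, Stacks.size]
    iterate 12 refine hadd ?_ (htail _)
    exact htail _

/-- The time for emptying the stacks. -/
theorem clean_halts (f : Flags) (s : Stacks) (ho : s.out = []) :
    Nonempty (EvalsToInTime (machine xp).step (Point.cfg xp (.clean, f, s))
      (some (cfg xp (none, {}, { out := [f.acc] }))) (s.size + 1)) := by
  induction hk : s.size using Nat.strong_induction_on generalizing s with
  | _ k ih =>
  rcases Nat.eq_zero_or_pos s.size with h0 | h0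
  · obtain rfl : s = {} := by
      obtain ⟨⟩ := s
      simp only [Stacks.size, Nat.add_eq_zero_iff, List.length_eq_zero_iff] at h0
      simp_all
    refine ⟨⟨⟨1, ?_⟩, Nat.le_add_left 1 k⟩⟩
    change some (TM2.stepAux (prog xp .clean) f.toReg (Stacks.get {})) = _
    rw [stepAux_get, exec_clean_halt]
    rfl
  · obtain ⟨s', he, ho', hs⟩ := exec_clean (xp := xp) f s h0
    obtain ⟨h₁⟩ := Reaches.single he
    obtain ⟨h₂⟩ := ih _ (hk ▸ hs) s' (ho'.trans ho) rfl
    have h := EvalsToInTime.trans _ _ _ _ _ _ h₁ h₂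
    exact ⟨⟨h.toEvalsTo, h.steps_le_m.trans (by omega)⟩⟩

/-! ### Why the search succeeds -/

/-- A set `G` of vertices that guides the search: it is a hitting set, and all hitting sets that are
contained in it have at least `b` elements. -/
def IsGuide (rows : List (Finset (Fin n))) (b : ℕ) (G : Finset (Fin n)) : Prop :=
  (∀ e ∈ rows, e ∩ G ≠ ∅) ∧ ∀ T ⊆ G, (∀ e ∈ rows, e ∩ T ≠ ∅) → b ≤ T.card

/-- The search that removes single vertices has to succeed below `W` if only `d` vertices need to be
removed in order to get to a guide. -/
def VertexGoal (rows : List (Finset (Fin n))) (b d : ℕ) (W : Finset (Fin n)) : Prop :=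
  ∃ G, IsGuide rows b G ∧ G ⊆ W ∧ (W \ G).card ≤ d

/-- The search that removes all but one vertex of a hyperedge has to succeed below `W` if only `d`
such steps are needed in order to get to a subset of a guide. -/
def EdgeGoal (rows : List (Finset (Fin n))) (b d : ℕ) (W : Finset (Fin n)) : Prop :=
  ∃ (G S : Finset (Fin n)) (e : Fin n → Finset (Fin n)), IsGuide rows b G ∧ G ⊆ W ∧
    (∀ v ∈ S, v ∈ e v ∧ e v ∈ rows ∧ Disjoint ((e v).erase v) G) ∧
    W \ S.biUnion (fun v => (e v).erase v) ⊆ G ∧ S.card ≤ d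

theorem inter_ne_empty_of_subset {e G W : Finset (Fin n)} (h : e ∩ G ≠ ∅) (hGW : G ⊆ W) :
    e ∩ W ≠ ∅ := fun h0 =>
  h (Finset.subset_empty.1 (h0 ▸ Finset.inter_subset_inter_left hGW))

theorem VertexGoal.step {rows : List (Finset (Fin n))} {b d : ℕ} {W T : Finset (Fin n)}
    (h : VertexGoal rows b d W) (hTW : T ⊆ W) (hT : IsMinHit rows T) (hb : T.card < b) :
    ∃ d₀ X, d = d₀ + 1 ∧ IsChild false rows W T X ∧ VertexGoal rows b d₀ X := by
  obtain ⟨G, hG, hGW, hd⟩ := h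
  obtain ⟨t, htT, htG⟩ := Finset.not_subset.1 fun hTG : T ⊆ G => hb.not_ge (hG.2 T hTG hT.1)
  have ht : t ∈ W \ G := Finset.mem_sdiff.2 ⟨hTW htT, htG⟩
  have hcard := Finset.card_erase_add_one ht
  refine ⟨d - 1, W.erase t, by omega, ⟨t, htT, rfl⟩, G, hG,
    Finset.subset_erase.2 ⟨hGW, htG⟩, ?_⟩
  rw [Finset.erase_sdiff_comm]
  omega

theorem union_biUnion_erase {S : Finset (Fin n)} {v : Fin n} (hv : v ∈ S)
    (f : Fin n → Finset (Fin n)) : f v ∪ (S.erase v).biUnion f = S.biUnion f := by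
  rw [← Finset.biUnion_insert, Finset.insert_erase hv]

theorem EdgeGoal.step {rows : List (Finset (Fin n))} {b d : ℕ} {W T : Finset (Fin n)}
    (h : EdgeGoal rows b d W) (hTW : T ⊆ W) (hT : IsMinHit rows T) (hb : T.card < b) :
    ∃ d₀ X, d = d₀ + 1 ∧ IsChild true rows W T X ∧ EdgeGoal rows b d₀ X := by
  obtain ⟨G, S, e, hG, hGW, hS, hWG, hd⟩ := h
  obtain ⟨v, hv⟩ : S.Nonempty := by
    rw [Finset.nonempty_iff_ne_empty]
    rintro rfl
    rw [Finset.biUnion_empty, Finset.sdiff_empty] at hWG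
    exact hb.not_ge (hG.2 T (hTW.trans hWG) hT.1)
  have hcard := Finset.card_erase_add_one hv
  obtain ⟨hve, he, hdis⟩ := hS v hv
  refine ⟨d - 1, W \ (e v).erase v, by omega, ⟨e v, he, v, hve, rfl⟩, G, S.erase v, e, hG,
    Finset.subset_sdiff.2 ⟨hGW, hdis.symm⟩, fun u hu => hS u (Finset.mem_of_mem_erase hu), ?_,
    by omega⟩
  rwa [sdiff_sdiff_left, Finset.sup_eq_union, union_biUnion_erase hv fun v => (e v).erase v]

theorem isHittingSet_coe {x : MMHSInstance} {T : Finset (Fin x.n)} :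
    x.hypergraph.IsHittingSet (T : Set (Fin x.n)) ↔ ∀ e ∈ x.edges, e ∩ T ≠ ∅ := by
  simp only [Hypergraph.IsHittingSet, MMHSInstance.hypergraph, Set.subset_univ, true_and,
    Set.mem_ofPred_eq, forall_exists_index, and_imp, ← Finset.nonempty_iff_ne_empty]
  constructor
  · intro h e he
    have := h _ e he rfl
    rwa [← Finset.coe_inter, Finset.coe_nonempty] at this
  · rintro h _ e he rfl
    rw [← Finset.coe_inter, Finset.coe_nonempty]
    exact h e he

theorem bddAbove_mmhs (x : MMHSInstance) :
    BddAbove {k | ∃ S, x.hypergraph.IsMinimalHittingSet S ∧ S.ncard = k} := by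
  refine ⟨x.n, ?_⟩
  rintro _ ⟨S, -, rfl⟩
  exact (Set.ncard_le_card S).trans_eq (by simp)

theorem isMinHit_iff {x : MMHSInstance} {T : Finset (Fin x.n)} :
    IsMinHit x.edges T ↔ x.hypergraph.IsMinimalHittingSet (T : Set (Fin x.n)) := by
  constructor
  · rintro ⟨h₁, h₂⟩
    refine ⟨isHittingSet_coe.2 h₁, fun S hS hST v hv => ?_⟩
    obtain ⟨e, he, hev⟩ := h₂ v hv
    obtain ⟨u, hue, huS⟩ := hS.2 e ⟨e, he, rfl⟩
    have : u ∈ e ∩ T := Finset.mem_inter.2 ⟨hue, hST huS⟩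
    rw [hev, Finset.mem_singleton] at this
    exact this ▸ huS
  · intro h
    have h₁ := isHittingSet_coe.1 h.1
    refine ⟨h₁, fun v hv => ?_⟩
    by_contra! hno
    -- otherwise `v` could be removed from `T`
    have h₂ : x.hypergraph.IsHittingSet ((T.erase v : Finset (Fin x.n)) : Set (Fin x.n)) := by
      refine isHittingSet_coe.2 fun e he h0 => ?_
      rw [Finset.inter_erase, Finset.erase_eq_empty_iff] at h0
      exact h0.elim (h₁ e he) (hno e he)
    exact Finset.notMem_erase v T (h.2 h₂ (Finset.erase_subset v T) hv)

/-- A minimal hitting set with at least `b` elements gives a guide: choose `b` of its elements, and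
a private hyperedge for each of these; then remove from the set of all vertices the rest of the
chosen hyperedges. -/
theorem exists_guide {rows : List (Finset (Fin n))} {b : ℕ} {X : Finset (Fin n)}
    (hX : IsMinHit rows X) (hb : b ≤ X.card) :
    ∃ (S : Finset (Fin n)) (e : Fin n → Finset (Fin n)), S.card = b ∧
      (∀ v ∈ S, v ∈ e v ∧ e v ∈ rows) ∧
      IsGuide rows b (Finset.univ \ S.biUnion fun v => (e v).erase v) := by
  classical
  obtain ⟨S, hSX, hS⟩ := Finset.exists_subset_card_eq hb
  have hpriv : ∀ v, ∃ e, v ∈ X → e ∈ rows ∧ e ∩ X = {v} := fun v => by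
    by_cases hv : v ∈ X
    · obtain ⟨e, he⟩ := hX.2 v hv
      exact ⟨e, fun _ => he⟩
    · exact ⟨∅, fun h => absurd h hv⟩
  choose e he using hpriv
  have hve : ∀ v ∈ X, v ∈ e v := fun v hv =>
    Finset.mem_of_mem_inter_left (((he v hv).2 ▸ Finset.mem_singleton_self v : v ∈ e v ∩ X))
  refine ⟨S, e, hS, fun v hv => ⟨hve v (hSX hv), (he v (hSX hv)).1⟩, fun f hf => ?_,
    fun T hT hhit => hS ▸ Finset.card_le_card fun v hv => ?_⟩
  · refine inter_ne_empty_of_subset (hX.1 f hf) fun u hu => ?_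
    simp only [Finset.mem_sdiff, Finset.mem_univ, true_and, Finset.mem_biUnion, not_exists, not_and]
    intro v hv huv
    have : u ∈ e v ∩ X := Finset.mem_inter.2 ⟨Finset.mem_of_mem_erase huv, hu⟩
    rw [(he v (hSX hv)).2, Finset.mem_singleton] at this
    exact Finset.ne_of_mem_erase huv this
  · obtain ⟨u, hu⟩ := Finset.nonempty_iff_ne_empty.2 (hhit _ (he v (hSX hv)).1)
    obtain ⟨hue, huT⟩ := Finset.mem_inter.1 hu
    have := hT huT
    simp only [Finset.mem_sdiff, Finset.mem_univ, true_and, Finset.mem_biUnion, not_exists,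
      not_and] at this
    have huv : u = v := by
      by_contra h
      exact this v hv (Finset.mem_erase.2 ⟨h, hue⟩)
    exact huv ▸ huT

theorem IsMinHit.card_le_mmhs {x : MMHSInstance} {T : Finset (Fin x.n)}
    (hT : IsMinHit x.edges T) : T.card ≤ x.hypergraph.mmhs :=
  le_csSup (bddAbove_mmhs x) ⟨T, isMinHit_iff.1 hT, Set.ncard_coe_finset T⟩

theorem exists_isMinHit_of_le_mmhs {x : MMHSInstance} (h : x.β ≤ x.hypergraph.mmhs) :
    ∃ X : Finset (Fin x.n), IsMinHit x.edges X ∧ x.β ≤ X.card := by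
  classical
  have hne : {k | ∃ S, x.hypergraph.IsMinimalHittingSet S ∧ S.ncard = k}.Nonempty := by
    by_contra h0
    rw [Set.not_nonempty_iff_eq_empty] at h0
    rw [Hypergraph.mmhs, h0, csSup_empty] at h
    exact absurd x.β_pos (by simpa using h)
  obtain ⟨S, hS, hcard⟩ := Nat.sSup_mem hne (bddAbove_mmhs x)
  refine ⟨S.toFinset, isMinHit_iff.2 (by rwa [Set.coe_toFinset]), ?_⟩
  rw [← Set.ncard_eq_toFinset_card', hcard]
  exact h

/-! ### The whole computation -/

theorem le_maxCount (vs : List ι) (a : ℕ) (rows : List (ι → Bool)) :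
    a ≤ maxCount vs a rows ∧ ∀ e ∈ rows, vs.countP e ≤ maxCount vs a rows := by
  induction rows generalizing a with
  | nil => exact ⟨le_rfl, by simp⟩
  | cons e rows ih =>
    obtain ⟨h₁, h₂⟩ := ih (max a (vs.countP e))
    exact ⟨(le_max_left _ _).trans h₁,
      List.forall_mem_cons.2 ⟨(le_max_right _ _).trans h₁, h₂⟩⟩

theorem maxCount_eq (vs : List ι) (a : ℕ) (rows : List (ι → Bool)) :
    maxCount vs a rows = a ∨ ∃ e ∈ rows, maxCount vs a rows = vs.countP e := by
  induction rows generalizing a with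
  | nil => exact .inl rfl
  | cons e rows ih =>
    rcases ih (max a (vs.countP e)) with h | ⟨f, hf, h⟩
    · rcases max_choice a (vs.countP e) with h' | h'
      · exact .inl (h.trans h')
      · exact .inr ⟨e, List.mem_cons_self, h.trans h'⟩
    · exact .inr ⟨f, List.mem_cons_of_mem _ hf, h⟩

theorem countP_mem (e : Finset (Fin n)) :
    (List.finRange n).countP (fun v => decide (v ∈ e)) = e.card :=
  countP_finRange _ _ fun _ => decide_eq_true_iff

theorem maxCount_eq_α (x : MMHSInstance) :
    maxCount (List.finRange x.n) 0 (x.edges.map fun e v => decide (v ∈ e)) = x.α := by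
  have himg : Set.ncard '' x.hypergraph.edgeSet = {k | ∃ e ∈ x.edges, k = e.card} := by
    ext k
    simp only [MMHSInstance.hypergraph, Set.mem_image, Set.mem_ofPred_eq]
    constructor
    · rintro ⟨_, ⟨e, he, rfl⟩, rfl⟩
      exact ⟨e, he, Set.ncard_coe_finset e⟩
    · rintro ⟨e, he, rfl⟩
      exact ⟨e, ⟨e, he, rfl⟩, Set.ncard_coe_finset e⟩
  obtain ⟨-, hle⟩ := le_maxCount (List.finRange x.n) 0 (x.edges.map fun e v => decide (v ∈ e))
  simp only [List.forall_mem_map, countP_mem] at hle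
  rw [MMHSInstance.α, Hypergraph.maxEdgeSize, himg]
  apply le_antisymm
  · rcases maxCount_eq (List.finRange x.n) 0 (x.edges.map fun e v => decide (v ∈ e)) with
      h | ⟨f, hf, h⟩
    · rw [h]
      exact Nat.zero_le _
    · obtain ⟨e, he, rfl⟩ := List.mem_map.1 hf
      rw [h, countP_mem]
      refine le_csSup ⟨x.n, ?_⟩ ⟨e, he, rfl⟩
      rintro _ ⟨e, -, rfl⟩
      exact (Finset.card_le_univ e).trans_eq (Fintype.card_fin _)
  · apply csSup_le'
    rintro _ ⟨e, he, rfl⟩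
    exact hle e he

theorem card_le_α {x : MMHSInstance} {e : Finset (Fin x.n)} (he : e ∈ x.edges) : e.card ≤ x.α := by
  rw [← maxCount_eq_α, ← countP_mem]
  exact (le_maxCount _ _ _).2 _ (List.mem_map_of_mem he)

theorem α_le (x : MMHSInstance) : x.α ≤ x.n := by
  rw [← maxCount_eq_α]
  rcases maxCount_eq (List.finRange x.n) 0 (x.edges.map fun e v => decide (v ∈ e)) with
    h | ⟨f, -, h⟩
  · rw [h]
    exact Nat.zero_le _
  · rw [h]
    exact List.countP_le_length.trans_eq List.length_finRange

theorem hornerValue_bits (b : ℕ) : hornerValue 0 b.bits.reverse = b := by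
  rw [hornerValue, List.foldl_reverse]
  induction b using Nat.binaryRec' with
  | zero => rfl
  | bit b k hk ih =>
    rw [Nat.bits_append_bit _ _ hk, List.foldr_cons, ih, Nat.bit_val]

theorem encode_eq (x : MMHSInstance) :
    x.encode = x.β.bits.map some ++ none ::
      ((List.replicate x.n true).map some ++ none :: edgeCode x.edges) := by
  simp only [MMHSInstance.encode, edgeCode, rowCode, List.flatMap_map, MMHSInstance.row,
    List.map_map, Function.comp_def]

theorem entry_univ : entry (Finset.univ : Finset (Fin n)) =
    .beg :: (List.replicate n (.vert true) ++ [.fin]) := by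
  simp [entry]

/-- The copy of `β` on which the machine works: a hitting set has at most `n` elements, so that all
`β > n` can be treated alike. -/
def cutβ (x : MMHSInstance) : ℕ := min x.β (x.n + 1)

/-- The depth of the search: `α β` for the vertex rule, and `β` for the edge rule, with `cutβ` in
place of `β`. For the edge rule the machine uses `1` in place of `α`, so that both cases end in the
same multiplication. -/
noncomputable def depth (xp : Bool) (x : MMHSInstance) : ℕ :=
  (if xp then 1 else x.α) * cutβ x

/-- Time for the preparation of the search. -/
noncomputable def setupTime (x : MMHSInstance) : ℕ :=
  x.β.bits.length * (2 * (x.n + 1) + 3) + x.edges.length * (4 * x.n + 4) +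
    (x.α + 1) * (2 * cutβ x + 3) + x.β.bits.length + x.n + 6

theorem reaches_setup (x : MMHSInstance) :
    Reaches xp (setupTime x) (.readBeta, {}, { inp := x.encode })
      (.pick, {}, Stacks.between { cap := U (x.n + 1 - x.β) } x.edges (cutβ x) (depth xp x) 0
        (entry (Finset.univ : Finset (Fin x.n)))) := by
  have h₁ := reaches_readBeta (xp := xp) {} {} x.β.bits []
    ((List.replicate x.n true).map some ++ none :: edgeCode x.edges)
  have h₂ := reaches_readVerts (xp := xp) {} { bin := x.β.bits.reverse } x.n 0 0 [.fin]
    (edgeCode x.edges)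
  have h₃ := reaches_horner (xp := xp) {} {
    inp := edgeCode x.edges, alp := U xp.toNat, agenda := entry (Finset.univ : Finset (Fin x.n)) }
    x.β.bits.reverse 0 (x.n + 1)
  rw [← encode_eq, List.append_nil] at h₁
  rw [← entry_univ, Nat.zero_add, Nat.zero_add] at h₂
  rw [hornerValue_bits, Nat.zero_min, Nat.sub_zero, List.length_reverse] at h₃
  have h₁₂₃ := (h₁.trans h₂).trans h₃
  cases xp with
  | true =>
    have h₄ := reaches_mult (xp := true) {} {
      inp := edgeCode x.edges, cap := U (x.n + 1 - x.β),
      agenda := entry (Finset.univ : Finset (Fin x.n)) } 1 (cutβ x) 0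
    rw [Nat.zero_add] at h₄
    refine (h₁₂₃.trans h₄).mono ?_
    rw [setupTime, Nat.succ_mul x.α]
    omega
  | false =>
    have h₄ := reaches_maxRows (xp := false) {} {
      bet := U (cutβ x), cap := U (x.n + 1 - x.β),
      agenda := entry (Finset.univ : Finset (Fin x.n)) } (List.finRange x.n)
      (x.edges.map fun e v => decide (v ∈ e)) [] 0 (Nat.zero_le _)
    have h₅ := reaches_maxRowRewind (xp := false) {} {
      bet := U (cutβ x), cap := U (x.n + 1 - x.β), alp := U x.α,
      agenda := entry (Finset.univ : Finset (Fin x.n)) } (edgeCode x.edges).reverse []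
    have h₆ := reaches_mult (xp := false) {} {
      inp := edgeCode x.edges, cap := U (x.n + 1 - x.β),
      agenda := entry (Finset.univ : Finset (Fin x.n)) } x.α (cutβ x) 0
    rw [maxCount_eq_α, List.append_nil] at h₄
    rw [List.append_nil, List.reverse_reverse] at h₅
    rw [Nat.zero_add] at h₆
    refine (h₁₂₃.trans ((h₄.trans h₅).trans h₆)).mono ?_
    rw [setupTime, Nat.succ_mul x.α, List.length_map, List.length_finRange, List.length_reverse,
      length_edgeCode]
    have : x.edges.length * (4 * x.n + 4) =
      x.edges.length * (3 * x.n + 3) + x.edges.length * (x.n + 1) := by ring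
    omega

theorem initList_eq (l : List (Option Bool)) :
    initList (machine xp) l = Point.cfg xp (.readBeta, {}, { inp := l }) := by
  refine TM2.Cfg.mk.injEq .. |>.mpr ⟨rfl, rfl, ?_⟩
  funext k
  cases k <;> rfl

theorem haltList_eq (l : List Bool) :
    haltList (machine xp) l = cfg xp (none, {}, { out := l }) := by
  refine TM2.Cfg.mk.injEq .. |>.mpr ⟨rfl, rfl, ?_⟩
  funext k
  cases k <;> rfl

/-- The machine with its input and output alphabets. -/
def machineAux (xp : Bool) : TM2ComputableAux (Option Bool) Bool where
  tm := machine xp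
  inputAlphabet := Equiv.refl (Option Bool)
  outputAlphabet := Equiv.refl Bool

/-- The number of symbols on the stacks when the search begins. -/
noncomputable def setupSize (xp : Bool) (x : MMHSInstance) : ℕ :=
  x.edges.length * (x.n + 1) + (x.n + 1) + cutβ x + depth xp x + (x.n + 2)

/-- The machine decides the problem, if its branching rule fits to the sufficient condition `C` for
the success of the search. -/
theorem outputs (x : MMHSInstance) (k Q : ℕ) (C : ℕ → Finset (Fin x.n) → Prop)
    (hk : 1 ≤ k) (hkw : ∀ t < cutβ x, width xp x.edges.length x.n t ≤ k)
    (hQ : nodeTime x.edges.length x.n (cutβ x) + k * (x.n + 2) + 1 ≤ Q)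
    (hlive : ∀ d W, C d W → ∀ e ∈ x.edges, e ∩ W ≠ ∅)
    (hstep : ∀ d W T, C d W → T ⊆ W → IsMinHit x.edges T → T.card < cutβ x →
      ∃ d₀ X, d = d₀ + 1 ∧ IsChild xp x.edges W T X ∧ C d₀ X)
    (hinit : x.β ≤ x.hypergraph.mmhs → C (depth xp x) Finset.univ) :
    Nonempty (TM2OutputsInTime (machine xp) x.encode
      (some [decide (x.β ≤ x.hypergraph.mmhs)])
      (setupTime x + 2 * searchTime Q k (depth xp x) + setupSize xp x + 2)) := by
  set F := searchTime Q k (depth xp x) with hF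
  have hsize : Stacks.size (Stacks.between { cap := U (x.n + 1 - x.β) } x.edges (cutβ x)
      (depth xp x) 0 (entry (Finset.univ : Finset (Fin x.n)))) ≤ setupSize xp x := by
    simp only [Stacks.size, Stacks.between, length_edgeCode, length_entry, List.length_replicate,
      List.length_nil, setupSize]
    omega
  have hsetup := reaches_setup (xp := xp) x
  have hsearch := search (xp := xp) x.edges (cutβ x) k Q C hk hkw hQ hlive hstep (depth xp x)
    Finset.univ { cap := U (x.n + 1 - x.β) } 0 []
  rw [List.append_nil, ← hF] at hsearch
  -- it suffices to reach the final phase with the correct answer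
  suffices h : ∃ (f : Flags) (s : Stacks), f.acc = decide (x.β ≤ x.hypergraph.mmhs) ∧ s.out = [] ∧
      s.size ≤ setupSize xp x + F ∧
      Reaches xp (setupTime x + F + 1) (.readBeta, {}, { inp := x.encode }) (.clean, f, s) by
    obtain ⟨f, s, hf, ho, hs, ⟨h⟩⟩ := h
    obtain ⟨h'⟩ := clean_halts (xp := xp) f s ho
    have h'' := EvalsToInTime.trans _ _ _ _ _ _ h h'
    rw [hf] at h''
    unfold TM2OutputsInTime
    rw [← haltList_eq] at h''
    rw [Option.map_some, initList_eq]
    exact ⟨⟨h''.toEvalsTo, h''.steps_le_m.trans (by omega)⟩⟩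
  rcases hsearch with ⟨T, s', hT, hb, ho, hs, h⟩ | ⟨hC, h⟩
  · have hn : T.card ≤ x.n := (Finset.card_le_univ T).trans_eq (Fintype.card_fin _)
    have hyes : x.β ≤ x.hypergraph.mmhs := by
      refine le_trans ?_ hT.card_le_mmhs
      rw [cutβ] at hb
      omega
    exact ⟨_, s', (decide_eq_true hyes).symm, ho, by omega,
      (hsetup.trans h).mono (Nat.le_succ _)⟩
  · have hno : ¬ x.β ≤ x.hypergraph.mmhs := fun h => hC (hinit h)
    refine ⟨{}, _, (decide_eq_false hno).symm, ?_, ?_, (hsetup.trans h).trans (.single rfl)⟩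
    · rfl
    · simp only [Stacks.size, Stacks.between, List.length_nil, Stacks.set, Stacks.get,
        List.tail_nil] at hsize ⊢
      omega

/-! ### Time bounds -/

theorem size_eq (x : MMHSInstance) :
    MMHS.size x = x.β.bits.length + x.n + 2 + x.edges.length * (x.n + 1) := by
  change x.encode.length = _
  rw [encode_eq]
  simp only [List.length_append, List.length_cons, List.length_map, List.length_replicate,
    length_edgeCode]
  omega

theorem nodeTime_le {m n b z : ℕ} (hn : n + 2 ≤ z) (hm : m * (n + 1) ≤ z) (hb : b ≤ n + 1) :
    nodeTime m n b ≤ 16 * z ^ 2 := by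
  have hround : roundTime m n ≤ 5 * z := by
    rw [roundTime]
    linarith [show m * (3 * n + 3) = 3 * (m * (n + 1)) by ring]
  have hexp : expandTime m n ≤ 6 * z ^ 2 + 3 * z := by
    have h : (m + 1) * ((n + 1) * (2 * n + 5)) ≤ 2 * z * (3 * z) := by
      rw [← mul_assoc]
      refine Nat.mul_le_mul ?_ (by omega)
      rw [Nat.succ_mul]
      omega
    rw [expandTime]
    nlinarith
  have h : (n + 1) * roundTime m n ≤ z * (5 * z) := Nat.mul_le_mul (by omega) hround
  rw [nodeTime]
  nlinarith

theorem cutβ_le (x : MMHSInstance) : cutβ x ≤ x.β ∧ cutβ x ≤ x.n + 1 ∧ 1 ≤ cutβ x := by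
  have := x.β_pos
  rw [cutβ]
  omega

theorem depth_le (x : MMHSInstance) : depth xp x ≤ (x.n + 1) * (x.n + 1) := by
  refine Nat.mul_le_mul ?_ (cutβ_le x).2.1
  have := α_le x
  split_ifs <;> omega

theorem time_le (x : MMHSInstance) :
    setupTime x + setupSize xp x + 2 ≤ 16 * MMHS.size x ^ 2 := by
  set z := MMHS.size x with hz
  have hsize := hz.trans (size_eq x)
  clear_value z
  obtain ⟨-, hb, -⟩ := cutβ_le x
  have hα := α_le x
  have hd : depth xp x ≤ z * z := (depth_le x).trans (Nat.mul_le_mul (by omega) (by omega))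
  have h₁ : x.β.bits.length * (2 * (x.n + 1) + 3) ≤ z * (4 * z) :=
    Nat.mul_le_mul (by omega) (by omega)
  have h₂ : (x.α + 1) * (2 * cutβ x + 3) ≤ z * (4 * z) := Nat.mul_le_mul (by omega) (by omega)
  have h₃ : x.edges.length * (4 * x.n + 4) = 4 * (x.edges.length * (x.n + 1)) := by ring
  have h₄ : 2 ≤ z := by omega
  have h₅ : 2 * z ≤ z * z := Nat.mul_le_mul_right z h₄
  rw [setupTime, setupSize, h₃, pow_two]
  linarith

theorem decidableInTime_of_outputs {T : MMHSInstance → ℕ} (xp : Bool)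
    (h : ∀ x : MMHSInstance, Nonempty (TM2OutputsInTime (machine xp) x.encode
      (some [decide (x.β ≤ x.hypergraph.mmhs)]) (T x))) :
    MMHS.DecidableInTime T := by
  refine ⟨machineAux xp, fun k => ?_, fun x => ?_⟩
  · change Finite (Γ k)
    change Stk at k
    cases k <;> infer_instance
  · have hx := h x
    have h₁ : (MMHS.encode x).map (machineAux xp).inputAlphabet.symm = x.encode := List.map_id _
    have h₂ : @decide (MMHS.Yes x) (Classical.propDecidable _) =
        decide (x.β ≤ x.hypergraph.mmhs) := decide_eq_decide.2 Iff.rfl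
    rw [h₁, h₂]
    exact hx

/-! ### The two branching rules -/

theorem exists_guide_of_yes {x : MMHSInstance} (h : x.β ≤ x.hypergraph.mmhs) :
    ∃ (S : Finset (Fin x.n)) (e : Fin x.n → Finset (Fin x.n)), S.card = cutβ x ∧
      (∀ v ∈ S, v ∈ e v ∧ e v ∈ x.edges) ∧
      IsGuide x.edges (cutβ x) (Finset.univ \ S.biUnion fun v => (e v).erase v) := by
  obtain ⟨X, hX, hb⟩ := exists_isMinHit_of_le_mmhs h
  exact exists_guide hX ((cutβ_le x).1.trans hb)

theorem vertexGoal_univ {x : MMHSInstance} (h : x.β ≤ x.hypergraph.mmhs) :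
    VertexGoal x.edges (cutβ x) (depth false x) Finset.univ := by
  obtain ⟨S, e, hS, he, hG⟩ := exists_guide_of_yes h
  refine ⟨_, hG, Finset.subset_univ _, ?_⟩
  rw [sdiff_sdiff_right_self, Finset.inf_eq_inter, Finset.univ_inter]
  calc (S.biUnion fun v => (e v).erase v).card ≤ S.card * x.α :=
        Finset.card_biUnion_le_card_mul _ _ _ fun v hv =>
          (Finset.card_erase_le).trans (card_le_α (he v hv).2)
    _ = depth false x := by rw [hS, mul_comm]; rfl

theorem edgeGoal_univ {x : MMHSInstance} (h : x.β ≤ x.hypergraph.mmhs) :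
    EdgeGoal x.edges (cutβ x) (depth true x) Finset.univ := by
  obtain ⟨S, e, hS, he, hG⟩ := exists_guide_of_yes h
  refine ⟨_, S, e, hG, Finset.subset_univ _, fun v hv => ⟨(he v hv).1, (he v hv).2, ?_⟩,
    subset_rfl, ?_⟩
  · exact Finset.disjoint_sdiff.mono_left
      (Finset.subset_biUnion_of_mem (fun v => (e v).erase v) hv)
  · rw [hS]
    exact (Nat.one_mul _).ge

theorem outputs_vertex (x : MMHSInstance) :
    Nonempty (TM2OutputsInTime (machine false) x.encode
      (some [decide (x.β ≤ x.hypergraph.mmhs)]) (52 * MMHS.size x ^ 4 * x.β ^ (x.α * x.β))) := by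
  set z := MMHS.size x with hz
  have hsize := hz.trans (size_eq x)
  obtain ⟨hβ, hn, hpos⟩ := cutβ_le x
  have hnode := nodeTime_le (m := x.edges.length) (b := cutβ x) (z := z) (n := x.n) (by omega)
    (by omega) hn
  have hk : cutβ x * (x.n + 2) + 1 ≤ z ^ 2 := by
    have := Nat.mul_le_mul (show cutβ x + 1 ≤ z by omega) (show x.n + 2 ≤ z by omega)
    rw [Nat.succ_mul, ← pow_two] at this
    omega
  have hd : depth false x + 1 ≤ z ^ 2 := by
    have h₁ := depth_le (xp := false) x
    have h₂ := Nat.mul_le_mul (show x.n + 2 ≤ z by omega) (show x.n + 2 ≤ z by omega)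
    nlinarith
  have hpow : cutβ x ^ depth false x ≤ x.β ^ (x.α * x.β) :=
    (Nat.pow_le_pow_left hβ _).trans
      (Nat.pow_le_pow_right x.β_pos (Nat.mul_le_mul_left _ hβ))
  obtain ⟨⟨h, ht⟩⟩ := outputs (xp := false) x (cutβ x) (18 * z ^ 2) (VertexGoal x.edges (cutβ x))
    hpos (fun t ht => ht) (by omega)
    (fun d W ⟨G, hG, hGW, _⟩ e he => inter_ne_empty_of_subset (hG.1 e he) hGW)
    (fun d W T => VertexGoal.step) vertexGoal_univ
  refine ⟨⟨h, ht.trans ?_⟩⟩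
  have htime := time_le (xp := false) x
  rw [← hz] at htime
  have hsearch : searchTime (18 * z ^ 2) (cutβ x) (depth false x) ≤
      18 * z ^ 2 * z ^ 2 * x.β ^ (x.α * x.β) :=
    Nat.mul_le_mul (Nat.mul_le_mul_left _ hd) hpow
  have h₁ : z ^ 2 * 1 ≤ z ^ 4 * x.β ^ (x.α * x.β) :=
    Nat.mul_le_mul (Nat.pow_le_pow_right (by omega) (by norm_num))
      (Nat.one_le_pow _ _ x.β_pos)
  nlinarith

theorem outputs_edge (x : MMHSInstance) :
    Nonempty (TM2OutputsInTime (machine true) x.encode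
      (some [decide (x.β ≤ x.hypergraph.mmhs)]) (52 * MMHS.size x ^ (x.β + 3))) := by
  set z := MMHS.size x with hz
  have hsize := hz.trans (size_eq x)
  obtain ⟨hβ, hn, hpos⟩ := cutβ_le x
  have hnode := nodeTime_le (m := x.edges.length) (b := cutβ x) (z := z) (n := x.n) (by omega)
    (by omega) hn
  have hk : z * (x.n + 2) + 1 ≤ 2 * z ^ 2 := by
    have := Nat.mul_le_mul_left z (show x.n + 2 ≤ z by omega)
    have : 1 ≤ z ^ 2 := Nat.one_le_pow _ _ (by omega)
    nlinarith
  have hdepth : depth true x = cutβ x := Nat.one_mul _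
  obtain ⟨⟨h, ht⟩⟩ := outputs (xp := true) x z (18 * z ^ 2) (EdgeGoal x.edges (cutβ x))
    (by omega) (fun t ht => show x.edges.length * (x.n + 1) ≤ z by omega) (by omega)
    (fun d W ⟨G, _, _, hG, hGW, _⟩ e he => inter_ne_empty_of_subset (hG.1 e he) hGW)
    (fun d W T => EdgeGoal.step) edgeGoal_univ
  refine ⟨⟨h, ht.trans ?_⟩⟩
  have htime := time_le (xp := true) x
  rw [← hz] at htime
  have hsearch : searchTime (18 * z ^ 2) z (depth true x) ≤ 18 * z ^ 2 * z * z ^ x.β := by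
    rw [hdepth]
    exact Nat.mul_le_mul (Nat.mul_le_mul_left _ (by omega))
      (Nat.pow_le_pow_right (by omega) hβ)
  have h₁ : z ^ 2 ≤ z ^ (x.β + 3) := Nat.pow_le_pow_right (by omega) (by omega)
  have h₂ : z ^ (x.β + 3) = z ^ 2 * z * z ^ x.β := by ring
  rw [h₂] at h₁ ⊢
  nlinarith

/-! ### The bounds of the three statements -/

/-- The cost `β ^ (αβ)` of the search is below the bound, up to a constant factor: if `αβ` is large,
then `c * log (αβ) ≥ 1`, and there are only finitely many other cases. -/
theorem exists_pow_le_mmhsBound {c : ℝ} (hc : 0 < c) :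
    ∃ C : ℕ, ∀ a b : ℕ, 0 < b → ((b ^ (a * b) : ℕ) : ℝ) ≤ mmhsBound c a b * C := by
  obtain ⟨N, hN⟩ := exists_nat_ge (Real.exp (1 / c))
  have hpos : ∀ a b : ℕ, 0 < mmhsBound c a b := fun a b => by
    rw [mmhsBound]
    split_ifs with h
    · exact one_pos
    · have ha : 0 < a := Nat.pos_of_ne_zero fun h0 => h (by simp [h0])
      have hb : 0 < b := Nat.pos_of_ne_zero fun h0 => h (by simp [h0])
      have hlog : 0 < Real.log ((a : ℝ) * b) := Real.log_pos (by exact_mod_cast not_le.1 h)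
      positivity
  obtain ⟨C, hC⟩ := exists_nat_ge (1 + ∑ p ∈ Finset.range N ×ˢ Finset.range N,
    ((p.2 ^ (p.1 * p.2) : ℕ) : ℝ) / mmhsBound c p.1 p.2)
  have hnonneg : ∀ p ∈ Finset.range N ×ˢ Finset.range N,
      0 ≤ ((p.2 ^ (p.1 * p.2) : ℕ) : ℝ) / mmhsBound c p.1 p.2 := fun p _ =>
    div_nonneg (Nat.cast_nonneg _) (hpos _ _).le
  have hC1 : (1 : ℝ) ≤ C := by linarith [Finset.sum_nonneg hnonneg]
  refine ⟨C, fun a b hb => ?_⟩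
  by_cases hsmall : a * b ≤ 1
  · have h1 : b ^ (a * b) = 1 := by
      rcases Nat.eq_zero_or_pos a with rfl | ha
      · simp
      · have : b ≤ a * b := Nat.le_mul_of_pos_left b ha
        obtain rfl : b = 1 := by omega
        simp
    rw [h1, mmhsBound, if_pos hsmall]
    simpa using hC1
  have ha : 0 < a := Nat.pos_of_ne_zero fun h0 => hsmall (by simp [h0])
  rcases lt_or_ge (a * b) N with hab | hab
  · have haN : a < N := (Nat.le_mul_of_pos_right a hb).trans_lt hab
    have hbN : b < N := (Nat.le_mul_of_pos_left b ha).trans_lt hab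
    have hle := Finset.single_le_sum hnonneg
      (Finset.mk_mem_product (Finset.mem_range.2 haN) (Finset.mem_range.2 hbN))
    rw [← div_le_iff₀' (hpos a b)]
    dsimp only at hle
    linarith
  · have habN : Real.exp (1 / c) ≤ (a : ℝ) * b := hN.trans (by exact_mod_cast hab)
    have hlog : 1 / c ≤ Real.log ((a : ℝ) * b) :=
      (Real.le_log_iff_exp_le (by positivity)).2 habN
    have hclog : 1 ≤ c * Real.log ((a : ℝ) * b) := by
      rwa [div_le_iff₀' hc] at hlog
    have hbase : (b : ℝ) ≤ c * b * Real.log ((a : ℝ) * b) := by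
      have : (0 : ℝ) ≤ b := Nat.cast_nonneg b
      nlinarith
    have hpow : (b : ℝ) ^ (a * b) ≤ (c * b * Real.log ((a : ℝ) * b)) ^ (a * b) := by gcongr
    have hone : (1 : ℝ) ≤ (a : ℝ) ^ b := one_le_pow₀ (by exact_mod_cast ha)
    have hbound : (b : ℝ) ^ (a * b) ≤ mmhsBound c a b := by
      rw [mmhsBound, if_neg hsmall]
      exact hpow.trans (le_mul_of_one_le_left ((by positivity : (0 : ℝ) ≤ _).trans hpow) hone)
    rw [Nat.cast_pow]
    exact hbound.trans (le_mul_of_one_le_right (hpos a b).le hC1)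

theorem computable_pow_self_mul_self : Computable fun k : ℕ => 52 * k ^ (k * k) := by
  have hpow : Primrec₂ ((· ^ ·) : ℕ → ℕ → ℕ) := Primrec₂.unpaired'.1 Nat.Primrec.pow
  have hmul : Primrec fun k : ℕ => k * k := Primrec.nat_mul.comp .id .id
  exact (Primrec.nat_mul.comp (.const 52) (hpow.comp .id hmul)).to_comp

end HittingSetMachine

open HittingSetMachine

theorem mainTheorem6 :
    MMHS.IsXP (fun x : MMHSInstance => x.β) ∧
    MMHS.IsFPT (fun x : MMHSInstance => x.α + x.β) ∧
    ∀ c : ℝ, 0 < c →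
      MMHS.DecidableInOStar (fun x : MMHSInstance => mmhsBound c x.α x.β) := by
  refine ⟨?_, ?_, fun c hc => ?_⟩
  · exact ⟨fun _ => 52, fun b => b + 3, Computable.const 52,
      (Primrec.nat_add.comp .id (.const 3)).to_comp,
      decidableInTime_of_outputs true outputs_edge⟩
  · refine ⟨_, 4, computable_pow_self_mul_self, decidableInTime_of_outputs false fun x => ?_⟩
    obtain ⟨h, ht⟩ := outputs_vertex x
    refine ⟨⟨h, ht.trans ?_⟩⟩
    have hpow : x.β ^ (x.α * x.β) ≤ (x.α + x.β) ^ ((x.α + x.β) * (x.α + x.β)) :=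
      (Nat.pow_le_pow_left (Nat.le_add_left _ _) _).trans
        (Nat.pow_le_pow_right (Nat.add_pos_right _ x.β_pos)
          (Nat.mul_le_mul (Nat.le_add_right _ _) (Nat.le_add_left _ _)))
    calc 52 * MMHS.size x ^ 4 * x.β ^ (x.α * x.β)
        ≤ 52 * MMHS.size x ^ 4 * (x.α + x.β) ^ ((x.α + x.β) * (x.α + x.β)) :=
          Nat.mul_le_mul_left _ hpow
      _ = _ := by ring
  · obtain ⟨C, hC⟩ := exists_pow_le_mmhsBound hc
    refine ⟨_, decidableInTime_of_outputs false outputs_vertex,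
      Polynomial.C (52 * C) * Polynomial.X ^ 4, fun x => ?_⟩
    have h := mul_le_mul_of_nonneg_left (hC x.α x.β x.β_pos)
      (Nat.cast_nonneg (α := ℝ) (52 * MMHS.size x ^ 4))
    rw [← Nat.cast_mul] at h
    refine h.trans_eq ?_
    simp only [Polynomial.eval_mul, Polynomial.eval_C, Polynomial.eval_pow, Polynomial.eval_X]
    push_cast
    ring
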